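/- Let $X$ be an additive abelian group and $R$ a commutative $\mathbb{Q}$-algebra. A *word* is a finite sequence $\mathbf w=(w_1,\dots,w_r)$ of letters $w_i=\binom{u_i}{v_i}$ with $u_i,v_i\in X$. Fix a *deck*, that is, a set $\mathfrak V$ of (admissible) words which is stable under permuting letters, deleting letters, negating a letter $\binom{u}{v}\mapsto\binom{-u}{-v}$, exchanging all upper and lower entries simultaneously ($\binom{u_i}{v_i}\mapsto\binom{v_i}{u_i}$), and replacing the first two letters $\binom{u_1}{v_1}\binom{u_2}{v_2}$ by $\binom{u_1+u_2}{v_1}\binom{u_2}{v_2-v_1}$ (hence under all flexions). For example, $\mathfrak V$ may consist of all words, or of the generic ones. A *bimould* is an $R$-valued function $A$ on $\mathfrak V$. Let $\mathfrak E=\mathfrak E\binom{u}{v}$ be a *flexion unit*: an $R$-valued function of one letter with $$\mathfrak E\tbinom{-u}{-v}=-\mathfrak E\tbinom{u}{v},\qquad \mathfrak E\tbinom{u_1}{v_1}\mathfrak E\tbinom{u_2}{v_2}=\mathfrak E\tbinom{u_1+u_2}{v_1}\mathfrak E\tbinom{u_2}{v_2-v_1}+\mathfrak E\tbinom{u_1+u_2}{v_2}\mathfrak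 E\tbinom{u_1}{v_1-v_2}$$ for all admissible $\binom{u}{v}$ and $\binom{u_1}{v_1}\binom{u_2}{v_2}$. It is also regarded as a bimould concentrated in length one. Let $\mathfrak O\binom uv=\mathfrak E\binom vu$ be the conjugate unit and let $\mathfrak{oz}(w_1,\dots,w_r)=\mathfrak O(w_1)\cdots\mathfrak O(w_r)$, with $\mathfrak{oz}(\varnothing)=1$. For words $\mathbf a,\mathbf b$ write ${}_{\mathbf a}\lceil\mathbf b$ (resp. $\mathbf a\rceil_{\mathbf b}$) for the result of adding the sum of the upper entries of $\mathbf a$ to the first upper entry of $\mathbf b$ (resp. the sum of the upper entries of $\mathbf b$ to the last upper entry of $\mathbf a$), and ${}_{\mathbf a}\lfloor\mathbf b$ (resp. $\mathbf a\rfloor_{\mathbf b}$) for the result of subtracting the last lower entry of $\mathbf a$ from all lower entries of $\mathbf b$ (resp. the first lower entry of $\mathbf b$ from all lower entries of $\mathbf a$). Put $$\mathsf{arit}(B)(A)(\mathbf w)=\sum_{\substack{\mathbf w=\mathbf a\mathbf b\mathbf c\\ \mathbf b,\mathbf c\ne\varnothing}}A(\mathbf a\,{}_{\mathbf b}\lceil\mathbf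 c)\,B(\mathbf b\rfloor_{\mathbf c})-\sum_{\substack{\mathbf w=\mathbf a\mathbf b\mathbf c\\ \mathbf a,\mathbf b\ne\varnothing}}A(\mathbf a\rceil_{\mathbf b}\,\mathbf c)\,B({}_{\mathbf a}\lfloor\mathbf b),$$ $$\mathsf{swap}(A)\tbinom{u_1,\dots,u_r}{v_1,\dots,v_r}=A\tbinom{v_r,\;v_{r-1}-v_r,\;\dots,\;v_1-v_2}{u_1+\cdots+u_r,\;u_1+\cdots+u_{r-1},\;\dots,\;u_1},$$ and, for a bimould $Y$ with $Y(\varnothing)=1$, $$\mathsf{ganit}(Y)(A)(\mathbf w)=\sum_{\mathbf w=b_1\mathbf c_1\cdots b_s\mathbf c_s}A\bigl(b_1\rceil_{\mathbf c_1}\cdots b_s\rceil_{\mathbf c_s}\bigr)\prod_{i=1}^sY\bigl({}_{b_i}\lfloor\mathbf c_i\bigr),$$ where the $b_i$ are letters and the $\mathbf c_i$ are possibly empty words; $\mathsf{ganit}(Y)$ is a bijection of the set of bimoulds onto itself. A bimould $A$ is *alternal* if $A(\varnothing)=0$ and, for all non-empty $\mathbf a,\mathbf b$ with $\mathbf a\mathbf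 b$ admissible, the sum of the values of $A$ over all shuffles of $\mathbf a$ and $\mathbf b$ (with multiplicity) is $0$. It is *$\mathfrak O$-alternal* if $\mathsf{ganit}(\mathfrak{oz})^{-1}(A)$ is alternal. Define $\mathfrak{re}_1=\mathfrak E$, $\mathfrak{re}_r=\mathsf{arit}(\mathfrak{re}_{r-1})(\mathfrak E)$ for $r\ge2$, and $\mathfrak{r\ddot o}_r=\mathsf{swap}(\mathfrak{re}_r)$, a bimould concentrated in length $r$. **Theorem.** For every flexion unit $\mathfrak E$, the bimould $$\mathfrak T\ddot{\mathfrak o}(\mathrm{re}^{-1})=\sum_{r\ge1}\frac1{r(r+1)}\,\mathfrak{r\ddot o}_r$$ is $\mathfrak O$-alternal. -/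

import Mathlib

open scoped BigOperators

namespace Flexion

/-! ### Words, flexions, shuffles -/

/-- A letter `(u, v)`; the first component is the upper entry, the second one the lower entry. -/
abbrev Letter (X : Type*) := X × X

/-- The sum `u_1 + ⋯ + u_r` of the upper entries of a word. -/
def uSum {X : Type*} [AddCommGroup X] (w : List (Letter X)) : X := (w.map Prod.fst).sum

/-- The flexion `⌈_a b`: the upper entries of `a` are added to the first upper entry of `b`. -/
def upLeft {X : Type*} [AddCommGroup X] (a b : List (Letter X)) : List (Letter X) :=
  match b with
  | [] => []
  | x :: b' => (uSum a + x.1, x.2) :: b'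

/-- The flexion `a ⌉_b`: the upper entries of `b` are added to the last upper entry of `a`. -/
def upRight {X : Type*} [AddCommGroup X] (a b : List (Letter X)) : List (Letter X) :=
  match a.getLast? with
  | none => []
  | some x => a.dropLast ++ [(x.1 + uSum b, x.2)]

/-- The flexion `⌊_a b`: the last lower entry of `a` is subtracted from every lower entry
of `b`. -/
def lowLeft {X : Type*} [AddCommGroup X] (a b : List (Letter X)) : List (Letter X) :=
  match a.getLast? with
  | none => b
  | some x => b.map fun y => (y.1, y.2 - x.2)

/-- The flexion `a ⌋_b`: the first lower entry of `b` is subtracted from every lower entry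
of `a`. -/
def lowRight {X : Type*} [AddCommGroup X] (a b : List (Letter X)) : List (Letter X) :=
  match b with
  | [] => a
  | x :: _ => a.map fun y => (y.1, y.2 - x.2)

/-- All shuffles of two words, listed with multiplicity. -/
def shuffles {α : Type*} : List α → List α → List (List α)
  | [], b => [b]
  | a, [] => [a]
  | x :: a, y :: b =>
      (shuffles a (y :: b)).map (fun w => x :: w) ++ (shuffles (x :: a) b).map (fun w => y :: w)
termination_by a b => a.length + b.length

/-! ### Decks and bimoulds -/

/-- The domain on which bimoulds are considered: a set of admissible ("variable") words over
`X × X` which is stable under the elementary operations out of which all flexions, `swap`, `neg`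
and `push` are composed.  The set of all words is a deck (bimoulds are then arbitrary functions on
words); so is the set of words whose upper entries, as well as whose lower entries, are linearly
independent over `ℤ`, on which functions such as `1 / u` and `1 / v` are defined everywhere. -/
structure Deck (X : Type*) [AddCommGroup X] where
  /-- The admissible words. -/
  words : Set (List (Letter X))
  sublist_mem : ∀ w w' : List (Letter X), w ∈ words → w'.Sublist w → w' ∈ words
  perm_mem : ∀ w w' : List (Letter X), w ∈ words → w'.Perm w → w' ∈ words
  neg_mem : ∀ (u v : X) (w : List (Letter X)), (u, v) :: w ∈ words → (-u, -v) :: w ∈ words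
  flex_mem : ∀ (u₁ v₁ u₂ v₂ : X) (w : List (Letter X)), (u₁, v₁) :: (u₂, v₂) :: w ∈ words →
    (u₁ + u₂, v₁) :: (u₂, v₂ - v₁) :: w ∈ words
  exchange_mem : ∀ w : List (Letter X), w ∈ words → w.map Prod.swap ∈ words

/-- Bimoulds with values in `R`.  Only the values on admissible words are meaningful: every
operation below computes its value on an admissible word from values on admissible words, and
every property below is required on admissible words only. -/
abbrev Bimould (X R : Type*) := List (Letter X) → R

/-- The bimould concentrated in length one which is given by a function of one letter. -/
def lengthOne {X R : Type*} [CommRing R] (F : X → X → R) : Bimould X R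
  | [x] => F x.1 x.2
  | _ => 0

/-- `amit B A (w) = ∑_{w = abc; b, c ≠ ∅} A(a ⌈_b c) B(b ⌋_c)`. -/
def amit {X R : Type*} [AddCommGroup X] [CommRing R] (B A : Bimould X R) : Bimould X R := fun w =>
  ∑ i ∈ Finset.range w.length, ∑ j ∈ Finset.Ioo i w.length,
    A (w.take i ++ upLeft ((w.take j).drop i) (w.drop j)) *
      B (lowRight ((w.take j).drop i) (w.drop j))

/-- `anit B A (w) = ∑_{w = abc; a, b ≠ ∅} A(a ⌉_b c) B(⌊_a b)`. -/
def anit {X R : Type*} [AddCommGroup X] [CommRing R] (B A : Bimould X R) : Bimould X R := fun w =>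
  ∑ i ∈ Finset.Ico 1 w.length, ∑ j ∈ Finset.Ioc i w.length,
    A (upRight (w.take i) ((w.take j).drop i) ++ w.drop j) *
      B (lowLeft (w.take i) ((w.take j).drop i))

/-- `arit B = amit B - anit B`. -/
def arit {X R : Type*} [AddCommGroup X] [CommRing R] (B A : Bimould X R) : Bimould X R := fun w =>
  amit B A w - anit B A w

/-- For `w = ((u_1, v_1), …, (u_r, v_r))` this is the word with letters
`(v_r, u_1 + ⋯ + u_r), (v_{r-1} - v_r, u_1 + ⋯ + u_{r-1}), …, (v_1 - v_2, u_1)`. -/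
def swapWord {X : Type*} [AddCommGroup X] (w : List (Letter X)) : List (Letter X) :=
  (List.range w.length).reverse.map fun i =>
    ((w.map Prod.snd).getD i 0 - (w.map Prod.snd).getD (i + 1) 0, uSum (w.take (i + 1)))

/-- The involution `swap` on bimoulds. -/
def swap {X R : Type*} [AddCommGroup X] (A : Bimould X R) : Bimould X R := fun w => A (swapWord w)

/-- `ganit Y A (w) = ∑ A(b_1⌉_{c_1} ⋯ b_s⌉_{c_s}) Y(⌊_{b_1} c_1) ⋯ Y(⌊_{b_s} c_s)`, the sum being over
all factorizations `w = b_1 c_1 ⋯ b_s c_s` with letters `b_i` and possibly empty words `c_i`, that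
is, over all ways to cut `w` into non-empty blocks `b_i c_i`.  (For `Y(∅) = 1` one gets the same
sum if the `b_i` are non-empty words and all `c_i` except possibly `c_s` are non-empty.) -/
def ganit {X R : Type*} [AddCommGroup X] [CommRing R] (Y A : Bimould X R) : Bimould X R := fun w =>
  ∑ κ : Composition w.length,
    A ((w.splitWrtComposition κ).flatMap fun bc => upRight (bc.take 1) (bc.drop 1)) *
      ((w.splitWrtComposition κ).map fun bc => Y (lowLeft (bc.take 1) (bc.drop 1))).prod

/-- A bimould is alternal if it vanishes on the empty word and on all shuffles of two non-empty
words. -/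
def Deck.IsAlternal {X R : Type*} [AddCommGroup X] [CommRing R] (D : Deck X)
    (A : Bimould X R) : Prop :=
  A [] = 0 ∧ ∀ a b : List (Letter X), a ≠ [] → b ≠ [] → a ++ b ∈ D.words →
    ((shuffles a b).map A).sum = 0

/-! ### Flexion units -/

/-- A flexion unit: an odd function of one letter which satisfies the tripartite identity. -/
structure Deck.IsFlexionUnit {X R : Type*} [AddCommGroup X] [CommRing R] (D : Deck X)
    (E : X → X → R) : Prop where
  odd : ∀ u v : X, [(u, v)] ∈ D.words → E (-u) (-v) = -E u v
  tripartite : ∀ u₁ v₁ u₂ v₂ : X, [(u₁, v₁), (u₂, v₂)] ∈ D.words →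
    E u₁ v₁ * E u₂ v₂ =
      E (u₁ + u₂) v₁ * E u₂ (v₂ - v₁) + E (u₁ + u₂) v₂ * E u₁ (v₁ - v₂)

/-- The conjugate unit `𝔒(u, v) = 𝔈(v, u)`. -/
def conjUnit {X R : Type*} (E : X → X → R) : X → X → R := fun u v => E v u

/-- The bimould `𝔬𝔷`: `𝔬𝔷(w_1, …, w_r) = 𝔒(w_1) ⋯ 𝔒(w_r)`. -/
def oz {X R : Type*} [CommRing R] (O : X → X → R) : Bimould X R := fun w =>
  (w.map fun x => O x.1 x.2).prod

/-- The bimoulds `𝔯𝔢_r`: `𝔯𝔢_1 = 𝔈` and `𝔯𝔢_r = arit(𝔯𝔢_{r-1})(𝔈)` for `r ≥ 2`. -/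
def re {X R : Type*} [AddCommGroup X] [CommRing R] (E : X → X → R) : ℕ → Bimould X R
  | 0 => 0
  | 1 => lengthOne E
  | n + 2 => arit (re E (n + 1)) (lengthOne E)

/-- The bimoulds `𝔯𝔬̈_r = swap(𝔯𝔢_r)`. -/
def ro {X R : Type*} [AddCommGroup X] [CommRing R] (E : X → X → R) (r : ℕ) : Bimould X R :=
  swap (re E r)

/-- The bimould `∑_{r ≥ 1} 𝔯𝔬̈_r / (r (r + 1))`.  As `𝔯𝔬̈_r` is concentrated in length `r`, the
terms with `r` greater than the length of `w` do not contribute to the value at `w`. -/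
def To {X R : Type*} [AddCommGroup X] [CommRing R] [Algebra ℚ R] (E : X → X → R) : Bimould X R :=
  fun w => ∑ r ∈ Finset.Icc 1 w.length, (1 / ((r : ℚ) * ((r : ℚ) + 1))) • ro E r w

/-! ### Invertibility of `ganit` -/

theorem flatMap_upRight {X : Type*} [AddCommGroup X] (L : List (List (Letter X)))
    (hL : ∀ l ∈ L, 0 < l.length) :
    (L.flatMap fun bc => upRight (bc.take 1) (bc.drop 1)).length = L.length := by
  induction L with
  | nil => rfl
  | cons l L ih =>
    have h1 := ih fun l' hl' => hL l' (List.mem_cons_of_mem _ hl')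
    have h2 := hL l List.mem_cons_self
    cases l with
    | nil => simp at h2
    | cons x t =>
      rw [List.flatMap_cons, List.length_append, h1]
      simp [upRight, Nat.add_comm]

theorem ones_term {X R : Type*} [AddCommGroup X] [CommRing R] (Y A : Bimould X R) (hY : Y [] = 1)
    (L : List (List (Letter X))) (hL : ∀ l ∈ L, l.length = 1) :
    A (L.flatMap fun bc => upRight (bc.take 1) (bc.drop 1)) *
      (L.map fun bc => Y (lowLeft (bc.take 1) (bc.drop 1))).prod = A L.flatten := by
  have h1 : (L.flatMap fun bc => upRight (bc.take 1) (bc.drop 1)) = L.flatten := by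
    rw [← List.flatMap_id]
    apply List.flatMap_congr
    intro l hl
    obtain ⟨x, rfl⟩ := List.length_eq_one_iff.1 (hL l hl)
    simp [upRight, uSum]
  have h2 : (L.map fun bc => Y (lowLeft (bc.take 1) (bc.drop 1))).prod = 1 := by
    apply List.prod_eq_one
    intro y hy
    obtain ⟨l, hl, rfl⟩ := List.mem_map.1 hy
    obtain ⟨x, rfl⟩ := List.length_eq_one_iff.1 (hL l hl)
    simp [lowLeft, hY]
  rw [h1, h2, mul_one]

/-- The value of `ganit Y A` at `w` is `A(w)` plus a quantity which only depends on the values of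
`A` on shorter words. -/
theorem ganit_sub_eq {X R : Type*} [AddCommGroup X] [CommRing R] (Y A B : Bimould X R)
    (hY : Y [] = 1) (w : List (Letter X))
    (h : ∀ w' : List (Letter X), w'.length < w.length → A w' = B w') :
    ganit Y A w - A w = ganit Y B w - B w := by
  have key : ∀ C : Bimould X R, ganit Y C w - C w =
      ∑ κ ∈ Finset.univ.erase (Composition.ones w.length),
        C ((w.splitWrtComposition κ).flatMap fun bc => upRight (bc.take 1) (bc.drop 1)) *
          ((w.splitWrtComposition κ).map fun bc => Y (lowLeft (bc.take 1) (bc.drop 1))).prod := by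
    intro C
    have h1 := ones_term Y C hY (w.splitWrtComposition (Composition.ones w.length)) (by
      intro l hl
      have h2 : l.length ∈
          (w.splitWrtComposition (Composition.ones w.length)).map List.length :=
        List.mem_map_of_mem hl
      rw [List.map_length_splitWrtComposition] at h2
      simpa using (List.mem_replicate.1 h2).2)
    rw [List.flatten_splitWrtComposition] at h1
    unfold ganit
    rw [← Finset.add_sum_erase _ _ (Finset.mem_univ (Composition.ones w.length)), h1]
    ring
  rw [key A, key B]
  refine Finset.sum_congr rfl fun κ hκ => ?_
  rw [h]
  rw [flatMap_upRight _ fun l hl => List.length_pos_of_mem_splitWrtComposition hl,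
    List.length_splitWrtComposition]
  exact lt_of_le_of_ne κ.length_le fun h3 =>
    (Finset.ne_of_mem_erase hκ) (Composition.eq_ones_iff_length.2 h3)

theorem ganit_bijective {X R : Type*} [AddCommGroup X] [CommRing R] (Y : Bimould X R)
    (hY : Y [] = 1) : Function.Bijective (ganit Y : Bimould X R → Bimould X R) := by
  constructor
  · intro A B hAB
    have : ∀ (n : ℕ) (w : List (Letter X)), w.length < n → A w = B w := by
      intro n
      induction n with
      | zero => intro w hw; exact absurd hw (Nat.not_lt_zero _)
      | succ n ih =>
        intro w hw
        have h1 := ganit_sub_eq Y A B hY w fun w' hw' => ih w' (by omega)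
        rw [hAB] at h1
        exact sub_right_injective h1
    exact funext fun w => this _ w (Nat.lt_succ_self _)
  · intro T
    let S : ℕ → Bimould X R := fun n =>
      Nat.rec T (fun _ A => fun w => T w - (ganit Y A w - A w)) n
    have hS : ∀ (n : ℕ) (w : List (Letter X)),
        S (n + 1) w = T w - (ganit Y (S n) w - S n w) := fun _ _ => rfl
    have stab : ∀ (n m : ℕ) (w : List (Letter X)), w.length < n → w.length < m →
        S n w = S m w := by
      intro n
      induction n with
      | zero => intro m w hw; exact absurd hw (Nat.not_lt_zero _)
      | succ n ih =>
        intro m w hn hm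
        obtain ⟨m, rfl⟩ : ∃ k, m = k + 1 := ⟨m - 1, by omega⟩
        rw [hS, hS, ganit_sub_eq Y (S n) (S m) hY w fun w' hw' =>
          ih m w' (by omega) (by omega)]
    refine ⟨fun w => S (w.length + 1) w, funext fun w => ?_⟩
    have h1 := ganit_sub_eq Y (fun w => S (w.length + 1) w) (S w.length) hY w
      fun w' hw' => stab (w'.length + 1) w.length w' (Nat.lt_succ_self _) hw'
    have h2 := hS w.length w
    rw [← h1] at h2
    linear_combination h2

/-- The operator `ganit Y`, for `Y(∅) = 1`, as a bijection of the set of bimoulds. -/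
noncomputable def ganitEquiv {X R : Type*} [AddCommGroup X] [CommRing R] (Y : Bimould X R)
    (hY : Y [] = 1) : Bimould X R ≃ Bimould X R :=
  Equiv.ofBijective (ganit Y) (ganit_bijective Y hY)

theorem oz_nil {X R : Type*} [CommRing R] (O : X → X → R) : oz O [] = 1 := by simp [oz]

/-- A bimould `A` is `𝔒`-alternal if `ganit(𝔬𝔷)⁻¹(A)` is alternal. -/
def Deck.IsOAlternal {X R : Type*} [AddCommGroup X] [CommRing R] (D : Deck X)
    (O : X → X → R) (A : Bimould X R) : Prop :=
  D.IsAlternal ((ganitEquiv (oz O) (oz_nil O)).symm A)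

end Flexion

/-!
The bimould `To E` has an explicit expression in terms of the conjugate unit `O`. For a word `w` of
length `r` and a letter `x` of `w`, the corolla with root `x` is the product of
`O(u_1 + ⋯ + u_r, v_x)` and of the factors `O(u_y, v_y - v_x)` for the other letters `y`. The
tripartite identity shows that the swap of `re E r` is the sum of all corollas, the one whose root
is the `k`-th letter having the coefficient `r + 1 - k` (`ro_eq_corollaSum`).

The operator `ganit (oz O)` is computed by reading a word letter by letter (`ganit_oz_eq_gan`). It
respects the concatenation product (`gan_conv`), and it interacts in a simple way with the insertion
of a root between two factors (`gan_rootSum`). The bimould `combAt O` takes shuffles to products, by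
the tripartite identity, and its image under `ganit (oz O)` is `1 - O`, where `1` is the unit of the
concatenation product (`isSymmetralOn_combAt`, `gan_combAt`). Hence its powers `S = combPow O s N`
and their inverses take shuffles to products as well, and they are mapped to the `N`-th power of
`1 - O` and to its inverse. These bimoulds are always taken relative to the lower entry `s` of some
letter.

Putting a root between `S` and its inverse gives an alternal bimould `conjRoot O N`: in a shuffle
whose root belongs to one of the two words, the letters of the other word contribute a value of the
product of `S` and its inverse, which vanishes (`isAlternal_conjRoot`). Its image under
`ganit (oz O)` is a sum of corollas in which a root with `i` letters before it and `j` letters after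
it has the coefficient `(-1) ^ i * N.choose i * (N + j).choose N` (`gan_conjRoot`). The coefficient
`(j + 1) / (r (r + 1))`, `r = i + j + 1`, of `To E` is, for `r ≤ n`, a combination of these for
`N < n` which does not depend on `i` and `j` (`sum_weight_mul`). So `To E` agrees, up to
any given length, with the image of an alternal bimould under `ganit (oz O)`, and the latter
operator is unitriangular with respect to the length.
-/

namespace Flexion

/-! ### Sums over factorizations of a word -/

section WordSums

variable {α R : Type*} [CommRing R]

/-- The sum of `F p q` over all factorizations `w = p q` into two possibly empty words. -/
def splitSum : List α → (List α → List α → R) → R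
  | [], F => F [] []
  | x :: w, F => F [] (x :: w) + splitSum w fun p q => F (x :: p) q

/-- The sum of `F p x q` over all factorizations `w = p x q` with a marked letter `x`. -/
def rootSum : List α → (List α → α → List α → R) → R
  | [], _ => 0
  | x :: w, F => F [] x w + rootSum w fun p y q => F (x :: p) y q

/-- The concatenation product of two functions on words. -/
def conv (A B : List α → R) (w : List α) : R := splitSum w fun p q => A p * B q

/-- The sum of the values of `A` over all shuffles of `a` and `b`. -/
def shuffleSum (A : List α → R) (a b : List α) : R := ((shuffles a b).map A).sum

theorem splitSum_congr {w : List α} {F G : List α → List α → R}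
    (h : ∀ p q, p ++ q = w → F p q = G p q) : splitSum w F = splitSum w G := by
  induction w generalizing F G with
  | nil => exact h [] [] rfl
  | cons x w ih =>
    rw [splitSum, splitSum, h [] (x :: w) rfl, ih fun p q hpq => h (x :: p) q (by simp [hpq])]

theorem splitSum_add (w : List α) (F G : List α → List α → R) :
    splitSum w (fun p q => F p q + G p q) = splitSum w F + splitSum w G := by
  induction w generalizing F G with
  | nil => rfl
  | cons x w ih => simp only [splitSum, ih]; ring

theorem splitSum_mul_left (c : R) (w : List α) (F : List α → List α → R) :
    splitSum w (fun p q => c * F p q) = c * splitSum w F := by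
  induction w generalizing F with
  | nil => rfl
  | cons x w ih => simp only [splitSum, ih]; ring

theorem splitSum_zero (w : List α) : splitSum w (fun _ _ => (0 : R)) = 0 := by
  induction w with
  | nil => rfl
  | cons x w ih => simp only [splitSum, ih]; ring

theorem splitSum_sub (w : List α) (F G : List α → List α → R) :
    splitSum w (fun p q => F p q - G p q) = splitSum w F - splitSum w G := by
  induction w generalizing F G with
  | nil => rfl
  | cons x w ih => simp only [splitSum, ih]; ring

theorem rootSum_congr {w : List α} {F G : List α → α → List α → R}
    (h : ∀ p x q, p ++ x :: q = w → F p x q = G p x q) : rootSum w F = rootSum w G := by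
  induction w generalizing F G with
  | nil => rfl
  | cons x w ih =>
    rw [rootSum, rootSum, h [] x w rfl, ih fun p y q hpq => h (x :: p) y q (by simp [hpq])]

theorem rootSum_add (w : List α) (F G : List α → α → List α → R) :
    rootSum w (fun p x q => F p x q + G p x q) = rootSum w F + rootSum w G := by
  induction w generalizing F G with
  | nil => simp [rootSum]
  | cons x w ih => simp only [rootSum, ih]; ring

theorem rootSum_sub (w : List α) (F G : List α → α → List α → R) :
    rootSum w (fun p x q => F p x q - G p x q) = rootSum w F - rootSum w G := by
  induction w generalizing F G with
  | nil => simp [rootSum]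
  | cons x w ih => simp only [rootSum, ih]; ring

theorem rootSum_mul_left (c : R) (w : List α) (F : List α → α → List α → R) :
    rootSum w (fun p x q => c * F p x q) = c * rootSum w F := by
  induction w generalizing F with
  | nil => simp [rootSum]
  | cons x w ih => simp only [rootSum, ih]; ring

theorem rootSum_zero (w : List α) : rootSum w (fun _ _ _ => (0 : R)) = 0 := by
  induction w with
  | nil => rfl
  | cons x w ih => simp only [rootSum, ih]; ring

theorem rootSum_finset_sum {ι : Type*} (s : Finset ι) (w : List α)
    (F : ι → List α → α → List α → R) :
    rootSum w (fun p x q => ∑ i ∈ s, F i p x q) = ∑ i ∈ s, rootSum w (F i) := by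
  classical
  induction s using Finset.induction_on with
  | empty => simp [rootSum_zero]
  | insert i s hi ih => simp only [Finset.sum_insert hi, rootSum_add, ih]

theorem rootSum_concat (w : List α) (y : α) (F : List α → α → List α → R) :
    rootSum (w ++ [y]) F = rootSum w (fun p x q => F p x (q ++ [y])) + F w y [] := by
  induction w generalizing F with
  | nil => simp [rootSum]
  | cons x w ih => simp only [List.cons_append, rootSum, ih]; ring

theorem rootSum_map {β : Type*} (f : β → α) (w : List β) (F : List α → α → List α → R) :
    rootSum (w.map f) F = rootSum w fun p x q => F (p.map f) (f x) (q.map f) := by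
  induction w generalizing F with
  | nil => rfl
  | cons x w ih => simp only [List.map_cons, rootSum, ih, List.map_nil]

/-- The function on words that separates the first letter of its argument. -/
def onFirst (F : α → List α → R) : List α → R
  | [] => 0
  | x :: q => F x q

/-- Marking a letter amounts to cutting the word in front of it. -/
theorem rootSum_eq_splitSum (w : List α) (F : List α → α → List α → R) :
    rootSum w F = splitSum w fun p => onFirst (F p) := by
  induction w generalizing F with
  | nil => rfl
  | cons x w ih => rw [rootSum, splitSum, ih]; rfl

theorem splitSum_comm {β : Type*} (a : List α) (b : List β)
    (F : List α → List α → List β → List β → R) :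
    (splitSum a fun a₁ a₂ => splitSum b fun b₁ b₂ => F a₁ a₂ b₁ b₂) =
      splitSum b fun b₁ b₂ => splitSum a fun a₁ a₂ => F a₁ a₂ b₁ b₂ := by
  induction a generalizing F with
  | nil => rfl
  | cons x a ih => simp only [splitSum, ih, splitSum_add]

theorem splitSum_eq_sum_range (w : List α) (F : List α → List α → R) :
    splitSum w F = ∑ i ∈ Finset.range (w.length + 1), F (w.take i) (w.drop i) := by
  induction w generalizing F with
  | nil => simp [splitSum]
  | cons x w ih => rw [splitSum, ih, List.length_cons, Finset.sum_range_succ' _ (w.length + 1), add_comm]; rfl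

theorem splitSum_length (w : List α) (f : ℕ → ℕ → R) :
    (splitSum w fun p q => f p.length q.length) =
      ∑ ij ∈ Finset.HasAntidiagonal.antidiagonal w.length, f ij.1 ij.2 := by
  induction w generalizing f with
  | nil => simp [splitSum]
  | cons x w ih =>
    have := ih fun i j => f (i + 1) j
    simp only [splitSum, List.length_cons, List.length_nil, this,
      Finset.Nat.antidiagonal_succ, Finset.sum_cons, Finset.sum_map]
    rfl

theorem conv_nil (A B : List α → R) : conv A B [] = A [] * B [] := rfl

theorem conv_cons (A B : List α → R) (x : α) (w : List α) :
    conv A B (x :: w) = A [] * B (x :: w) + conv (fun p => A (x :: p)) B w := rfl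

/-- The unit of the concatenation product. -/
def convOne : List α → R
  | [] => 1
  | _ :: _ => 0

/-- The inverse of `A` with respect to the concatenation product, if `A [] = 1`. -/
def convInv (A : List α → R) : List α → R
  | [] => 1
  | x :: w => -∑ i ∈ Finset.range (w.length + 1), A (x :: w.take i) * convInv A (w.drop i)
termination_by w => w.length
decreasing_by simp

theorem conv_convInv {A : List α → R} (hA : A [] = 1) : conv A (convInv A) = convOne := by
  funext w
  cases w with
  | nil => simp [conv_nil, hA, convInv, convOne]
  | cons x w =>
    rw [conv_cons, hA, conv, splitSum_eq_sum_range, convInv, convOne]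
    ring

theorem conv_left_cancel {A B C : List α → R} (hA : A [] = 1) (h : conv A B = conv A C) :
    B = C := by
  funext w
  induction hn : w.length using Nat.strong_induction_on generalizing w with
  | _ n ih =>
    have hw := congrFun h w
    cases w with
    | nil => simpa [conv_nil, hA] using hw
    | cons x w =>
      have : conv (fun p => A (x :: p)) B w = conv (fun p => A (x :: p)) C w :=
        splitSum_congr fun p q hpq => by
          rw [ih q.length (by rw [← hn, ← hpq]; simp) q rfl]
      rw [conv_cons, conv_cons, this, hA] at hw
      linear_combination hw

/-! ### Shuffle sums -/

theorem shuffleSum_nil_left (A : List α → R) (b : List α) : shuffleSum A [] b = A b := by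
  simp [shuffleSum, shuffles]

theorem shuffleSum_nil_right (A : List α → R) (a : List α) : shuffleSum A a [] = A a := by
  cases a <;> simp [shuffleSum, shuffles]

theorem shuffleSum_cons_cons (A : List α → R) (x y : α) (a b : List α) :
    shuffleSum A (x :: a) (y :: b) =
      shuffleSum (fun w => A (x :: w)) a (y :: b) +
        shuffleSum (fun w => A (y :: w)) (x :: a) b := by
  simp only [shuffleSum]
  rw [shuffles]
  simp [Function.comp_def]

theorem perm_of_mem_shuffles {a b w : List α} (h : w ∈ shuffles a b) : w.Perm (a ++ b) := by
  induction a, b using shuffles.induct generalizing w with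
  | case1 b => simp [shuffles] at h; simp [h]
  | case2 a ha => 
    cases a <;> simp [shuffles] at h <;> simp [h]
  | case3 x a y b ih1 ih2 =>
    rw [shuffles] at h
    simp only [List.mem_append, List.mem_map] at h
    rcases h with ⟨w, hw, rfl⟩ | ⟨w, hw, rfl⟩
    · exact (ih1 hw).cons x
    · exact ((ih2 hw).cons y).trans (List.perm_middle (l₁ := x :: a)).symm

theorem shuffleSum_congr {A B : List α → R} {a b : List α}
    (h : ∀ w : List α, w.Perm (a ++ b) → A w = B w) : shuffleSum A a b = shuffleSum B a b := by
  unfold shuffleSum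
  rw [List.map_congr_left fun w hw => h w (perm_of_mem_shuffles hw)]

theorem shuffleSum_add (A B : List α → R) (a b : List α) :
    shuffleSum (fun w => A w + B w) a b = shuffleSum A a b + shuffleSum B a b := by
  simp [shuffleSum, List.sum_map_add]

theorem shuffleSum_mul_left (c : R) (A : List α → R) (a b : List α) :
    shuffleSum (fun w => c * A w) a b = c * shuffleSum A a b := by
  simp [shuffleSum, List.sum_map_mul_left]

theorem shuffleSum_zero (a b : List α) : shuffleSum (fun _ => (0 : R)) a b = 0 := by
  simp [shuffleSum]

theorem shuffleSum_finset_sum {ι : Type*} (s : Finset ι) (A : ι → List α → R) (a b : List α) :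
    shuffleSum (fun w => ∑ i ∈ s, A i w) a b = ∑ i ∈ s, shuffleSum (A i) a b := by
  classical
  induction s using Finset.induction_on with
  | empty => simp [shuffleSum_zero]
  | insert i s hi ih => simp only [Finset.sum_insert hi, shuffleSum_add, ih]

/-- Shuffling is compatible with deconcatenation: a factorization of a shuffle of `a` and `b`
is a pair of shuffles of the factors of `a` and `b`. -/
theorem shuffleSum_splitSum (F : List α → List α → R) (a b : List α) :
    shuffleSum (fun w => splitSum w F) a b =
      splitSum a fun a₁ a₂ => splitSum b fun b₁ b₂ =>
        shuffleSum (fun p => shuffleSum (F p) a₂ b₂) a₁ b₁ := by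
  induction a, b using shuffles.induct generalizing F with
  | case1 b => simp only [splitSum, shuffleSum_nil_left]
  | case2 a ha => simp only [splitSum, shuffleSum_nil_right]
  | case3 x a y b ih1 ih2 =>
    rw [shuffleSum_cons_cons]
    simp only [splitSum, shuffleSum_add, ih1, ih2, splitSum_add, shuffleSum_nil_left,
      shuffleSum_nil_right, shuffleSum_cons_cons]
    ring

theorem shuffleSum_conv (A B : List α → R) (a b : List α) :
    shuffleSum (conv A B) a b =
      splitSum a fun a₁ a₂ => splitSum b fun b₁ b₂ =>
        shuffleSum A a₁ b₁ * shuffleSum B a₂ b₂ := by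
  have := shuffleSum_splitSum (fun p q => A p * B q) a b
  simp only [shuffleSum_mul_left] at this
  refine this.trans ?_
  simp only [mul_comm (A _), shuffleSum_mul_left]
  simp only [mul_comm]

theorem shuffleSum_onFirst (F : α → List α → R) (a b : List α) :
    shuffleSum (onFirst F) a b =
      onFirst (fun x a' => shuffleSum (F x) a' b) a +
        onFirst (fun y b' => shuffleSum (F y) a b') b := by
  cases a with
  | nil => cases b <;> simp [shuffleSum_nil_left, onFirst]
  | cons x a =>
    cases b with
    | nil => simp [shuffleSum_nil_right, onFirst]
    | cons y b => simp only [shuffleSum_cons_cons, onFirst]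

/-- In a shuffle of `a` and `b` with a marked letter, this letter comes either from `a` or
from `b`. -/
theorem shuffleSum_rootSum (F : List α → α → List α → R) (a b : List α) :
    shuffleSum (fun w => rootSum w F) a b =
      (rootSum a fun a₁ x a₂ => splitSum b fun b₁ b₂ =>
        shuffleSum (fun p => shuffleSum (F p x) a₂ b₂) a₁ b₁) +
      rootSum b fun b₁ y b₂ => splitSum a fun a₁ a₂ =>
        shuffleSum (fun p => shuffleSum (F p y) a₂ b₂) a₁ b₁ := by
  have h1 : ∀ (a₁ b₁ c : List α) (H : List α → α → List α → R),
      shuffleSum (fun p => onFirst (H p) c) a₁ b₁ =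
        onFirst (fun x c' => shuffleSum (fun p => H p x c') a₁ b₁) c := by
    intro a₁ b₁ c H
    cases c with
    | nil => exact shuffleSum_zero _ _
    | cons x c => rfl
  have h2 : ∀ (e c : List α) (H : List α → List α → α → List α → R),
      splitSum e (fun e₁ e₂ => onFirst (H e₁ e₂) c) =
        onFirst (fun x c' => splitSum e fun e₁ e₂ => H e₁ e₂ x c') c := by
    intro e c H
    cases c with
    | nil => exact splitSum_zero _
    | cons x c => rfl
  simp only [rootSum_eq_splitSum, shuffleSum_splitSum, shuffleSum_onFirst, shuffleSum_add, h1,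
    splitSum_add]
  congr 1
  · simp only [h2]
  · rw [splitSum_comm]
    simp only [h2]

/-! ### Symmetral functions on words -/

/-- `A` takes shuffles to products, for shuffles that belong to the set `C` of words. -/
def IsSymmetralOn (C : Set (List α)) (A : List α → R) : Prop :=
  ∀ a b, a ++ b ∈ C → shuffleSum A a b = A a * A b

/-- A set of words which contains the subwords of its elements. -/
def SublistClosed (C : Set (List α)) : Prop :=
  ∀ w w' : List α, w ∈ C → w'.Sublist w → w' ∈ C

theorem isSymmetralOn_convOne (C : Set (List α)) : IsSymmetralOn C (convOne : List α → R) := by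
  intro a b _
  cases a with
  | nil => simp [shuffleSum_nil_left, convOne]
  | cons x a =>
    cases b with
    | nil => simp [shuffleSum_nil_right, convOne]
    | cons y b => simp [shuffleSum_cons_cons, convOne, shuffleSum_zero]

theorem splitSum_splitSum_mul (A B : List α → R) (a b : List α) :
    (splitSum a fun a₁ a₂ => splitSum b fun b₁ b₂ => A a₁ * A b₁ * (B a₂ * B b₂)) =
      conv A B a * conv A B b := by
  rw [mul_comm]
  simp only [conv, ← splitSum_mul_left]
  refine splitSum_congr fun a₁ a₂ _ => ?_
  rw [mul_comm, ← splitSum_mul_left]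
  exact splitSum_congr fun b₁ b₂ _ => by ring

theorem sublist_append_split {a b a₁ a₂ b₁ b₂ : List α} (ha : a₁ ++ a₂ = a) (hb : b₁ ++ b₂ = b) :
    (a₁ ++ b₁).Sublist (a ++ b) ∧ (a₂ ++ b₂).Sublist (a ++ b) := by
  subst ha hb
  exact ⟨(List.sublist_append_left _ _).append (List.sublist_append_left _ _),
    (List.sublist_append_right _ _).append (List.sublist_append_right _ _)⟩

theorem isSymmetralOn_conv {C : Set (List α)} (hC : SublistClosed C) {A B : List α → R}
    (hA : IsSymmetralOn C A) (hB : IsSymmetralOn C B) : IsSymmetralOn C (conv A B) := by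
  intro a b h
  rw [shuffleSum_conv, ← splitSum_splitSum_mul]
  refine splitSum_congr fun a₁ a₂ ha => splitSum_congr fun b₁ b₂ hb => ?_
  obtain ⟨h1, h2⟩ := sublist_append_split ha hb
  rw [hA _ _ (hC _ _ h h1), hB _ _ (hC _ _ h h2)]

theorem isSymmetralOn_convInv {C : Set (List α)} (hC : SublistClosed C) {A : List α → R}
    (hA : IsSymmetralOn C A) (h1 : A [] = 1) : IsSymmetralOn C (convInv A) := by
  intro a b h
  induction hn : a.length + b.length using Nat.strong_induction_on generalizing a b with
  | _ n ih =>
    match a, b with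
    | [], b => simp [shuffleSum_nil_left, convInv]
    | x :: a, [] => simp [shuffleSum_nil_right, convInv]
    | x :: a, y :: b =>
      have hinv := conv_convInv h1
      have hzero : shuffleSum (conv A (convInv A)) (x :: a) (y :: b) = 0 := by
        rw [hinv, isSymmetralOn_convOne Set.univ _ _ trivial, convOne, zero_mul]
      have hprod := splitSum_splitSum_mul A (convInv A) (x :: a) (y :: b)
      rw [hinv, convOne, zero_mul] at hprod
      rw [shuffleSum_conv, ← hprod] at hzero
      rw [← sub_eq_zero, ← splitSum_sub] at hzero
      simp only [← splitSum_sub] at hzero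
      -- Only the trivial factorizations `a = ∅ a` and `b = ∅ b` contribute to this sum.
      have hterm : ∀ a₁ a₂ b₁ b₂, a₁ ++ a₂ = x :: a → b₁ ++ b₂ = y :: b →
          0 < a₁.length + b₁.length →
          shuffleSum A a₁ b₁ * shuffleSum (convInv A) a₂ b₂ -
            A a₁ * A b₁ * (convInv A a₂ * convInv A b₂) = 0 := by
        intro a₁ a₂ b₁ b₂ ha hb hpos
        obtain ⟨h2, h3⟩ := sublist_append_split ha hb
        have ha' := congrArg List.length ha
        have hb' := congrArg List.length hb
        simp only [List.length_append] at ha' hb'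
        rw [hA _ _ (hC _ _ h h2), ih _ (by rw [← hn]; omega) a₂ b₂ (hC _ _ h h3) rfl, sub_self]
      rw [splitSum, splitSum, splitSum_congr (w := b) (G := fun _ _ => 0), splitSum_zero,
        splitSum_congr (w := a) (G := fun _ _ => 0), splitSum_zero] at hzero
      · simp only [shuffleSum_nil_left, h1, one_mul, add_zero] at hzero
        exact sub_eq_zero.1 hzero
      · intro a₁ a₂ ha
        rw [← splitSum_zero (R := R) (y :: b)]
        exact splitSum_congr fun b₁ b₂ hb => hterm _ _ _ _ (by simp [ha]) hb (by simp)
      · intro b₁ b₂ hb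
        exact hterm _ _ _ _ rfl (by simp [hb]) (by simp)

end WordSums

/-! ### Closure properties of decks -/

section Decks

variable {X R : Type*} [AddCommGroup X] [CommRing R]

/-- Subtraction of `s` from the lower entry of a letter. -/
def lowerShift (s : X) (x : Letter X) : Letter X := (x.1, x.2 - s)

theorem lowerShift_def (s : X) : lowerShift s = fun x : Letter X => (x.1, x.2 - s) := rfl

@[simp] theorem uSum_nil : uSum ([] : List (Letter X)) = 0 := rfl

@[simp] theorem uSum_cons (x : Letter X) (w : List (Letter X)) :
    uSum (x :: w) = x.1 + uSum w := by simp [uSum]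

@[simp] theorem uSum_append (a b : List (Letter X)) : uSum (a ++ b) = uSum a + uSum b := by
  simp [uSum]

@[simp] theorem uSum_map_lowerShift (s : X) (w : List (Letter X)) :
    uSum (w.map (lowerShift s)) = uSum w := by
  rw [uSum, uSum, List.map_map]
  rfl

theorem uSum_perm {a b : List (Letter X)} (h : a.Perm b) : uSum a = uSum b :=
  (h.map Prod.fst).sum_eq

theorem map_lowerShift_lowerShift (s t : X) (w : List (Letter X)) :
    (w.map (lowerShift s)).map (lowerShift (t - s)) = w.map (lowerShift t) := by
  simp [Function.comp_def, lowerShift]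

theorem map_lowerShift_zero (w : List (Letter X)) : w.map (lowerShift 0) = w := by
  have h : (lowerShift 0 : Letter X → Letter X) = id := funext fun x => by simp [lowerShift]
  rw [h, List.map_id]

/-- The word obtained from `x m y` by the passage to the base point `v_y`, where the upper entry
of `x` is changed in such a way that the upper entries of the new word add up to `-u_y`. -/
def rotate (x : Letter X) (m : List (Letter X)) (y : Letter X) : List (Letter X) :=
  (-(uSum m + y.1), x.2 - y.2) :: m.map (lowerShift y.2)

namespace Deck

variable {D : Deck X}

theorem mem_of_perm {w w' : List (Letter X)} (h : w ∈ D.words) (hp : w.Perm w') : w' ∈ D.words :=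
  D.perm_mem w w' h hp.symm

/-- The first letter `x` may absorb the upper entries of a block `c`, while the lower entry
of `x` is subtracted from those of `c`. -/
theorem absorb_mem_append {x : Letter X} {c w : List (Letter X)} (h : x :: (c ++ w) ∈ D.words) :
    (x.1 + uSum c, x.2) :: (c.map (lowerShift x.2) ++ w) ∈ D.words := by
  induction c generalizing x w with
  | nil => simpa using h
  | cons y c ih =>
    have h1 := D.flex_mem _ _ _ _ _ h
    have h2 := ih (x := (x.1 + y.1, x.2)) (w := (y.1, y.2 - x.2) :: w)
      (mem_of_perm h1 (List.Perm.cons _ List.perm_middle.symm))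
    refine mem_of_perm (w := _ :: (_ ++ _)) h2 ?_
    rw [uSum_cons, add_assoc]
    exact List.Perm.cons _ (List.perm_middle.trans (by simp [lowerShift]))

theorem absorb_mem {x : Letter X} {c : List (Letter X)} (h : x :: c ∈ D.words) :
    (x.1 + uSum c, x.2) :: c.map (lowerShift x.2) ∈ D.words := by
  simpa using absorb_mem_append (w := []) (by simpa using h)

theorem merge_mem {x : Letter X} {c w : List (Letter X)} (h : x :: (c ++ w) ∈ D.words) :
    (x.1 + uSum c, x.2) :: w ∈ D.words :=
  D.sublist_mem _ _ (absorb_mem_append h) (by simp)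

theorem shift_mem {x : Letter X} {c : List (Letter X)} (h : x :: c ∈ D.words) :
    c.map (lowerShift x.2) ∈ D.words :=
  D.sublist_mem _ _ (absorb_mem h) (List.sublist_cons_self _ _)

/-- A relative version of `shift_mem`: the base point `s` may be replaced by a letter. -/
theorem rebase_mem {s : X} {x : Letter X} {c : List (Letter X)}
    (h : (x :: c).map (lowerShift s) ∈ D.words) : c.map (lowerShift x.2) ∈ D.words := by
  have := shift_mem (x := lowerShift s x) h
  rwa [lowerShift, map_lowerShift_lowerShift] at this

theorem map_shift_mem_of_perm {s : X} {w w' : List (Letter X)}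
    (h : w.map (lowerShift s) ∈ D.words) (hp : w.Perm w') : w'.map (lowerShift s) ∈ D.words :=
  mem_of_perm h (hp.map _)

theorem map_shift_mem_of_sublist {s : X} {w w' : List (Letter X)}
    (h : w.map (lowerShift s) ∈ D.words) (hp : w'.Sublist w) : w'.map (lowerShift s) ∈ D.words :=
  D.sublist_mem _ _ h (hp.map _)

/-- Two disjoint blocks can be contracted to one of their letters each. -/
theorem merge_pair_mem {s : X} {x y : Letter X} {a b : List (Letter X)}
    (h : (x :: a ++ y :: b).map (lowerShift s) ∈ D.words) :
    [(x.1 + uSum a, x.2 - s), (y.1 + uSum b, y.2 - s)] ∈ D.words := by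
  simp only [List.map_append, List.map_cons, List.cons_append] at h
  have h1 := merge_mem h
  have h2 := mem_of_perm h1 (w' := _ :: (b.map (lowerShift s) ++ [_]))
    ((List.Perm.swap _ _ _).trans (List.Perm.cons _ (List.perm_append_singleton _ _).symm))
  have h3 := merge_mem h2
  simp only [uSum_map_lowerShift, lowerShift] at h3
  exact mem_of_perm h3 (List.Perm.swap _ _ _)

/-- The dual of `Deck.flex_mem`, with the roles of the upper and lower entries exchanged. -/
theorem flex_mem' {u₁ v₁ u₂ v₂ : X} {w : List (Letter X)} (h : (u₁, v₁) :: (u₂, v₂) :: w ∈ D.words) :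
    (u₁, v₁ + v₂) :: (u₂ - u₁, v₂) :: w ∈ D.words := by
  have h1 := D.exchange_mem _ h
  have h2 := D.exchange_mem _ (D.flex_mem v₁ u₁ v₂ u₂ (w.map Prod.swap) h1)
  simpa using h2

theorem rotate_mem {x y : Letter X} {m : List (Letter X)} (h : x :: m ++ [y] ∈ D.words) :
    rotate x m y ∈ D.words := by
  have h1 : y :: x :: m ∈ D.words := mem_of_perm h (List.perm_append_singleton _ _)
  have h2 := flex_mem' (absorb_mem h1)
  have h3 := D.sublist_mem _ _ h2 (List.sublist_cons_self _ _)
  have h4 : x.1 - (y.1 + uSum (x :: m)) = -(uSum m + y.1) := by rw [uSum_cons]; abel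
  rwa [h4] at h3

theorem IsFlexionUnit.conj {E : X → X → R} (hE : D.IsFlexionUnit E) :
    D.IsFlexionUnit (conjUnit E) where
  odd u v h := hE.odd v u (by simpa using D.exchange_mem _ h)
  tripartite u₁ v₁ u₂ v₂ h := by
    have h1 := D.exchange_mem _ (D.flex_mem _ _ _ _ _ h)
    have h2 := hE.tripartite v₁ (u₁ + u₂) (v₂ - v₁) u₂ (by simpa using h1)
    have h3 := D.flex_mem _ _ _ _ _ (mem_of_perm h (List.Perm.swap _ _ _))
    have h4 := D.exchange_mem _ (D.sublist_mem _ _ h3 (List.sublist_cons_self _ _))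
    have h5 := hE.odd (v₁ - v₂) u₁ (by simpa using h4)
    rw [neg_sub] at h5
    simp only [conjUnit]
    rw [show v₁ + (v₂ - v₁) = v₂ by abel, show u₂ - (u₁ + u₂) = -u₁ by abel,
      show u₁ + u₂ - u₂ = u₁ by abel, h5] at h2
    linear_combination -h2

end Deck
end Decks

/-! ### Corolla sums -/

section Corollas

variable {X R : Type*} [AddCommGroup X] [CommRing R] {D : Deck X} {O : X → X → R}

/-- The product `∏ O(u_i, v_i - s)`, that is, the bimould `oz O` relative to the base point `s`. -/
def ozAt (O : X → X → R) (s : X) (w : List (Letter X)) : R :=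
  (w.map fun x => O x.1 (x.2 - s)).prod

/-- The sum over all letters `x` of `w = p x q` of `f p q` times the corolla
`O(u_1 + ⋯ + u_r, v_x - s) ∏ O(u_y, v_y - v_x)`, the product being over the letters `y`
of `p` and `q`. -/
def corollaSum (O : X → X → R) (f : ℕ → ℕ → R) (s : X) (w : List (Letter X)) : R :=
  rootSum w fun p x q =>
    f p.length q.length * (O (uSum w) (x.2 - s) * (ozAt O x.2 p * ozAt O x.2 q))

@[simp] theorem ozAt_nil (s : X) : ozAt O s [] = 1 := rfl

@[simp] theorem ozAt_cons (s : X) (x : Letter X) (w : List (Letter X)) :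
    ozAt O s (x :: w) = O x.1 (x.2 - s) * ozAt O s w := by simp [ozAt]

@[simp] theorem ozAt_append (s : X) (a b : List (Letter X)) :
    ozAt O s (a ++ b) = ozAt O s a * ozAt O s b := by simp [ozAt]

@[simp] theorem ozAt_map_lowerShift (s t : X) (w : List (Letter X)) :
    ozAt O (s - t) (w.map (lowerShift t)) = ozAt O s w := by
  simp [ozAt, Function.comp_def, lowerShift]

theorem corollaSum_nil (f : ℕ → ℕ → R) (s : X) : corollaSum O f s [] = 0 := rfl

/-- The tripartite identity, applied to the first letter and to the root of each corolla. -/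
theorem corollaSum_cons (hO : D.IsFlexionUnit O) (f : ℕ → R) {s : X} {x : Letter X}
    {w : List (Letter X)} (h : (x :: w).map (lowerShift s) ∈ D.words) :
    corollaSum O (fun _ => f) s (x :: w) =
      f w.length * (O (x.1 + uSum w) (x.2 - s) * ozAt O x.2 w) +
        O x.1 (x.2 - s) * corollaSum O (fun _ => f) s w -
        O (x.1 + uSum w) (x.2 - s) * corollaSum O (fun _ => f) x.2 w := by
  simp only [corollaSum]
  rw [rootSum, ← rootSum_mul_left, ← rootSum_mul_left, add_sub_assoc, ← rootSum_sub]
  simp only [ozAt_nil, one_mul, uSum_cons]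
  congr 1
  refine rootSum_congr fun p k q hw => ?_
  have h1 : (x :: [] ++ k :: (p ++ q)).map (lowerShift s) ∈ D.words := by
    refine Deck.map_shift_mem_of_perm h ?_
    rw [← hw]
    exact List.Perm.cons _ List.perm_middle
  have h2 := hO.tripartite _ _ _ _ (Deck.merge_pair_mem h1)
  have h3 : k.1 + uSum (p ++ q) = uSum w := by
    rw [← hw]; simp only [uSum_append, uSum_cons]; abel
  rw [h3, uSum_nil, add_zero, sub_sub_sub_cancel_right, sub_sub_sub_cancel_right] at h2
  rw [ozAt_cons]
  linear_combination -(f q.length * ozAt O k.2 p * ozAt O k.2 q) * h2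

/-- The corollas of a non-empty word add up to the product of the letters. -/
theorem corollaSum_one (hO : D.IsFlexionUnit O) {s : X} {w : List (Letter X)} (hw : w ≠ [])
    (h : w.map (lowerShift s) ∈ D.words) : corollaSum O (fun _ _ => 1) s w = ozAt O s w := by
  induction w generalizing s with
  | nil => exact absurd rfl hw
  | cons x w ih =>
    rw [corollaSum_cons hO (fun _ => 1) h, ozAt_cons]
    rcases eq_or_ne w [] with rfl | hne
    · simp [corollaSum_nil]
    · rw [ih hne (Deck.map_shift_mem_of_sublist h (List.sublist_cons_self _ _)),
        ih hne (Deck.rebase_mem h)]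
      ring

/-- The effect of `rotate` on corollas: a corolla of `rotate x m y` with root in `m` equals the one
of `m y` with the same root, relative to the base point `v_x`, and the corolla whose root is the
first letter is `-ozAt O v_x (m y)`. As the position of the former roots is shifted by one, the
weighted sums differ by multiples of the sum of all corollas, which is `ozAt O v_x (m y)`. -/
theorem corollaSum_rotate (hO : D.IsFlexionUnit O) {x y : Letter X} {m : List (Letter X)}
    (h : x :: m ++ [y] ∈ D.words) :
    corollaSum O (fun _ j => (j : R) + 1) 0 (rotate x m y) =
      corollaSum O (fun _ j => (j : R) + 1) x.2 (m ++ [y]) -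
        ((m.length : R) + 2) * ozAt O x.2 (m ++ [y]) := by
  have hmy : (m ++ [y]).map (lowerShift x.2) ∈ D.words := Deck.shift_mem h
  have hs : uSum (rotate x m y) = -y.1 := by
    simp only [rotate, uSum_cons, uSum_map_lowerShift]; abel
  have hone := corollaSum_one hO (by simp) hmy
  have hyx : [(y.1, y.2 - x.2)] ∈ D.words :=
    D.sublist_mem _ _ hmy (by simp [lowerShift])
  have hodd := hO.odd _ _ hyx
  rw [neg_sub] at hodd
  have key : corollaSum O (fun _ j => (j : R) + 1) 0 (rotate x m y) =
      -(((m.length : R) + 1) * ozAt O x.2 (m ++ [y])) + rootSum m fun p k q =>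
        ((q.length : R) + 1) * (O (uSum (m ++ [y])) (k.2 - x.2) *
          (ozAt O k.2 p * ozAt O k.2 (q ++ [y]))) := by
    rw [corollaSum, hs, rotate, rootSum, rootSum_map]
    congr 1
    · simp only [ozAt_nil, ozAt_append, ozAt_cons, List.length_map, ozAt_map_lowerShift, sub_zero,
        hodd]
      ring
    · refine rootSum_congr fun p k q hm => ?_
      have h1 : k :: (y :: x :: (p ++ q)) ∈ D.words := by
        refine Deck.mem_of_perm h ?_
        rw [← hm]
        refine (List.perm_append_singleton _ _).trans ?_
        refine List.Perm.trans ?_ (List.Perm.swap _ _ _)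
        refine List.Perm.cons _ ?_
        exact (List.Perm.cons _ List.perm_middle).trans (List.Perm.swap _ _ _)
      have h2 := hO.odd y.1 (y.2 - k.2) (D.sublist_mem _ _ (Deck.shift_mem h1) (by
        simp [lowerShift]))
      have h3 : x :: ([] ++ k :: (y :: (p ++ q))) ∈ D.words :=
        Deck.mem_of_perm h1 (by
          refine (List.Perm.cons _ (List.Perm.swap _ _ _)).trans (List.Perm.swap _ _ _))
      have h4 := hO.odd (uSum (m ++ [y])) (k.2 - x.2) (by
        have := Deck.merge_mem (x := lowerShift x.2 k) (w := [])
          (by simpa using Deck.shift_mem h3)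
        have e : uSum (m ++ [y]) = k.1 + (y.1 + (uSum p + uSum q)) := by
          rw [← hm]; simp only [uSum_append, uSum_cons, uSum_nil]; abel
        rw [e]
        simpa [lowerShift] using this)
      rw [neg_sub] at h2 h4
      have e : -(uSum m + y.1) = -uSum (m ++ [y]) := by simp
      have e2 : x.2 - y.2 - (k.2 - y.2) = x.2 - k.2 := by abel
      simp only [lowerShift, List.length_map, sub_zero, ozAt_cons, ozAt_append, ozAt_nil]
      rw [e, e2, h2, h4]
      have e3 := ozAt_map_lowerShift (O := O) k.2 y.2 p
      have e4 := ozAt_map_lowerShift (O := O) k.2 y.2 q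
      rw [e3, e4]
      ring
  have hall : corollaSum O (fun _ j => (j : R) + 1) x.2 (m ++ [y]) = 
      (rootSum m fun p k q =>
        ((q.length : R) + 1) * (O (uSum (m ++ [y])) (k.2 - x.2) *
          (ozAt O k.2 p * ozAt O k.2 (q ++ [y])))) + ozAt O x.2 (m ++ [y]) := by
    rw [← hone, corollaSum, corollaSum, rootSum_concat, rootSum_concat, ← add_assoc,
      ← rootSum_add]
    congr 1
    · refine rootSum_congr fun p k q _ => ?_
      simp only [List.length_append, List.length_singleton]
      push_cast
      ring
    · simp
  rw [key, hall]
  ring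

end Corollas

/-! ### The bimoulds `re` and their swaps -/

section Swap

variable {X R : Type*} [AddCommGroup X] [CommRing R] {D : Deck X} {E : X → X → R}

theorem lengthOne_of_length_ne {Y : Type*} {F : Y → Y → R} {w : List (Letter Y)}
    (h : w.length ≠ 1) : lengthOne F w = 0 := by
  match w, h with
  | [], _ => rfl
  | [_], h => exact absurd rfl h
  | _ :: _ :: _, _ => rfl

theorem length_upLeft (a b : List (Letter X)) : (upLeft a b).length = b.length := by
  cases b <;> simp [upLeft]

theorem length_upRight (a b : List (Letter X)) : (upRight a b).length = a.length := by
  rcases a.eq_nil_or_concat with rfl | ⟨l, x, rfl⟩ <;> simp [upRight]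

theorem amit_lengthOne (B : Bimould X R) (x y : Letter X) (m : List (Letter X)) :
    amit B (lengthOne E) (x :: m ++ [y]) =
      E (uSum (x :: m ++ [y])) y.2 * B ((x :: m).map (lowerShift y.2)) := by
  unfold amit
  rw [Finset.sum_eq_single 0, Finset.sum_eq_single (m.length + 1)]
  · have h1 : (x :: m ++ [y]).take (m.length + 1) = x :: m := by simp
    have h2 : (x :: m ++ [y]).drop (m.length + 1) = [y] := by simp
    rw [h1, h2]
    simp [upLeft, lowRight, lengthOne, lowerShift_def, uSum, add_assoc]
  · intro j hj hne
    rw [lengthOne_of_length_ne, zero_mul]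
    simp only [List.length_append, length_upLeft, List.length_take, List.length_drop]
    simp at hj ⊢
    omega
  · intro h
    simp at h
  · intro i hi hne
    refine Finset.sum_eq_zero fun j hj => ?_
    rw [lengthOne_of_length_ne, zero_mul]
    simp only [List.length_append, length_upLeft, List.length_take, List.length_drop]
    simp at hi hj ⊢
    omega
  · intro h
    simp at h

theorem anit_lengthOne (B : Bimould X R) (x y : Letter X) (m : List (Letter X)) :
    anit B (lengthOne E) (x :: m ++ [y]) =
      E (uSum (x :: m ++ [y])) x.2 * B ((m ++ [y]).map (lowerShift x.2)) := by
  unfold anit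
  rw [Finset.sum_eq_single 1, Finset.sum_eq_single (m.length + 2)]
  · have h1 : (x :: m ++ [y]).take (m.length + 2) = x :: m ++ [y] := by simp
    have h2 : (x :: m ++ [y]).drop (m.length + 2) = [] := by simp
    rw [h1, h2]
    simp [upRight, lowLeft, lengthOne, lowerShift_def, uSum]
  · intro j hj hne
    rw [lengthOne_of_length_ne, zero_mul]
    simp only [List.length_append, length_upRight, List.length_take, List.length_drop]
    simp at hj ⊢
    omega
  · intro h
    simp at h
  · intro i hi hne
    refine Finset.sum_eq_zero fun j hj => ?_
    rw [lengthOne_of_length_ne, zero_mul]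
    simp only [List.length_append, length_upRight, List.length_take, List.length_drop]
    simp at hi hj ⊢
    omega
  · intro h
    simp at h

theorem arit_of_length_le_one (A B : Bimould X R) {w : List (Letter X)} (h : w.length ≤ 1) :
    arit B A w = 0 := by
  unfold arit amit anit
  rw [Finset.sum_eq_zero, Finset.sum_eq_zero, sub_zero]
  · intro i hi
    simp at hi
    omega
  · intro i hi
    refine Finset.sum_eq_zero fun j hj => ?_
    simp at hi hj
    omega

theorem re_add_two (n : ℕ) (x y : Letter X) (m : List (Letter X)) :
    re E (n + 2) (x :: m ++ [y]) =
      E (uSum (x :: m ++ [y])) y.2 * re E (n + 1) ((x :: m).map (lowerShift y.2)) -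
        E (uSum (x :: m ++ [y])) x.2 * re E (n + 1) ((m ++ [y]).map (lowerShift x.2)) := by
  rw [re, arit, amit_lengthOne, anit_lengthOne]

/-- A word of length at least two has a first and a last letter. -/
theorem exists_eq_cons_append {α : Type*} {w : List α} (h : 2 ≤ w.length) :
    ∃ x m y, w = x :: m ++ [y] := by
  obtain ⟨x, w, rfl⟩ := List.exists_cons_of_length_pos (by omega : 0 < w.length)
  rcases w.eq_nil_or_concat with rfl | ⟨m, y, rfl⟩
  · simp at h
  · exact ⟨x, m, y, by simp⟩

/-- `re E r` is concentrated in length `r`. -/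
theorem re_of_length_ne {r : ℕ} {w : List (Letter X)} (h : w.length ≠ r) : re E r w = 0 := by
  induction r using Nat.strong_induction_on generalizing w with
  | _ r ih =>
    match r with
    | 0 => rfl
    | 1 => exact lengthOne_of_length_ne h
    | n + 2 =>
      rcases Nat.lt_or_ge 1 w.length with hw | hw
      · obtain ⟨x, m, y, rfl⟩ := exists_eq_cons_append hw
        rw [re_add_two, ih (n + 1) (by omega), ih (n + 1) (by omega)]
        · ring
        · simp at h ⊢; omega
        · simp at h ⊢; omega
      · exact arit_of_length_le_one _ _ hw

theorem length_swapWord (w : List (Letter X)) : (swapWord w).length = w.length := by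
  simp [swapWord]

/-- The letters after `x` are swapped among themselves, and the upper entry of `x` enters the
partial sums, hence the shift by `-x.1`. -/
theorem swapWord_cons (x : Letter X) (w : List (Letter X)) :
    swapWord (x :: w) = (swapWord w).map (lowerShift (-x.1)) ++
      [(x.2 - (w.map Prod.snd).headD 0, x.1)] := by
  simp only [swapWord, List.length_cons, List.range_succ_eq_map, List.reverse_cons,
    List.map_append, List.map_reverse, List.map_map]
  congr 1
  · congr 1
    refine List.map_congr_left fun i _ => ?_
    simp [lowerShift, add_comm]
  · cases w <;> simp

theorem swapWord_append_singleton (m : List (Letter X)) (y : Letter X) :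
    swapWord (m ++ [y]) = (y.2, uSum m + y.1) :: swapWord (m.map (lowerShift y.2)) := by
  induction m with
  | nil => simp [swapWord, uSum]
  | cons x m ih =>
    rw [List.cons_append, swapWord_cons, ih, List.map_cons, List.map_cons,
      swapWord_cons (lowerShift y.2 x)]
    simp only [List.cons_append, uSum_cons]
    congr 1
    · simp [lowerShift]; abel
    · congr 1
      cases m <;> simp [lowerShift]

theorem uSum_swapWord_cons (x : Letter X) (w : List (Letter X)) :
    uSum (swapWord (x :: w)) = x.2 := by
  induction w generalizing x with
  | nil => simp [swapWord]
  | cons y w ih =>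
    rw [swapWord_cons, uSum_append, uSum_map_lowerShift, ih]
    simp

/-- The recursion which defines `re`, transported by `swap`. -/
theorem ro_add_two (n : ℕ) (x y : Letter X) (m : List (Letter X)) :
    ro E (n + 2) (x :: m ++ [y]) =
      E x.2 x.1 * ro E (n + 1) (m ++ [y]) -
        E x.2 (uSum (x :: m ++ [y])) * ro E (n + 1) (rotate x m y) := by
  simp only [ro, swap]
  have h1 : swapWord (x :: m ++ [y]) = (swapWord (m ++ [y])).map (lowerShift (-x.1)) ++
      [(x.2 - ((m ++ [y]).map Prod.snd).headD 0, x.1)] := swapWord_cons x (m ++ [y])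
  have h2 : swapWord (x :: m ++ [y]) = (y.2, uSum (x :: m ++ [y])) ::
      ((swapWord (m.map (lowerShift y.2))).map (lowerShift (-x.1)) ++
        [(x.2 - ((m ++ [y]).map Prod.snd).headD 0, x.1)]) := by
    rw [h1, swapWord_append_singleton]
    simp [lowerShift, add_comm]
  have hu := uSum_swapWord_cons x (m ++ [y])
  rw [← List.cons_append, h2] at hu
  have h3 : (y.2, uSum (x :: m ++ [y])) ::
      (swapWord (m.map (lowerShift y.2))).map (lowerShift (-x.1)) =
        (swapWord (m ++ [y])).map (lowerShift (-x.1)) := by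
    rw [swapWord_append_singleton]
    simp [lowerShift, add_comm]
  rw [h2, ← List.cons_append, re_add_two, List.cons_append, hu, h3]
  congr 2
  · congr 1
    have := map_lowerShift_lowerShift (-x.1) 0 (swapWord (m ++ [y]))
    rwa [zero_sub, neg_neg, map_lowerShift_zero] at this
  · congr 1
    rw [rotate, swapWord_cons, List.map_append]
    have e : -(-(uSum m + y.1)) = uSum m + y.1 := neg_neg _
    have e2 : uSum (x :: m ++ [y]) = (uSum m + y.1) - -x.1 := by simp; abel
    rw [e2, map_lowerShift_lowerShift, e]
    congr 1
    simp only [List.map_cons, List.map_nil, lowerShift]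
    congr 2
    · cases m <;> simp [lowerShift]
    · abel

/-- The swap of `re E r` is the sum of all corollas, the one whose root is the `k`-th letter
having the coefficient `r + 1 - k`. -/
theorem ro_eq_corollaSum (hE : D.IsFlexionUnit E) {w : List (Letter X)} (hw : w ∈ D.words)
    (hne : w ≠ []) :
    ro E w.length w = corollaSum (conjUnit E) (fun _ j => (j : R) + 1) 0 w := by
  obtain ⟨n, hn⟩ : ∃ n, w.length = n + 1 :=
    ⟨w.length - 1, by have := List.length_pos_iff.2 hne; omega⟩
  rw [hn]
  clear hne
  induction n generalizing w with
  | zero =>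
    obtain ⟨x, rfl⟩ := List.length_eq_one_iff.1 hn
    simp [ro, swap, swapWord, re, lengthOne, corollaSum, rootSum, conjUnit]
  | succ n ih =>
    obtain ⟨x, m, y, rfl⟩ := exists_eq_cons_append (by omega : 2 ≤ w.length)
    have hmy : m ++ [y] ∈ D.words := D.sublist_mem _ _ hw (by simp)
    have hlen : m.length = n := by simp at hn; omega
    rw [ro_add_two, ih hmy (by simp [hlen]), ih (Deck.rotate_mem hw) (by simp [rotate, hlen]),
      corollaSum_rotate hE.conj hw, List.cons_append,
      corollaSum_cons hE.conj (fun j => (j : R) + 1)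
        (by rw [map_lowerShift_zero]; exact hw)]
    simp only [conjUnit, sub_zero, uSum_cons, List.length_append, List.length_singleton]
    push_cast
    ring

/-- Only the term with `r` equal to the length of `w` contributes to `To E w`. -/
theorem To_eq_corollaSum [Algebra ℚ R] (hE : D.IsFlexionUnit E) {w : List (Letter X)}
    (hw : w ∈ D.words) (hne : w ≠ []) :
    To E w = (1 / ((w.length : ℚ) * ((w.length : ℚ) + 1))) •
      corollaSum (conjUnit E) (fun _ j => (j : R) + 1) 0 w := by
  rw [To, Finset.sum_eq_single w.length, ro_eq_corollaSum hE hw hne]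
  · intro r _ hr
    rw [ro, swap, re_of_length_ne (by rw [length_swapWord]; exact hr.symm), smul_zero]
  · intro h
    exact absurd (Finset.mem_Icc.2 ⟨List.length_pos_iff.2 hne, le_rfl⟩) h

end Swap

/-! ### Cutting a word into blocks -/

section Blockings

variable {α : Type*}

/-- All ways to cut the word `c w` into non-empty blocks in such a way that the first block
begins with `c`. -/
def blockings : List α → List α → List (List (List α))
  | [], c => [[c]]
  | y :: w, c => blockings w (c ++ [y]) ++ (blockings w [y]).map fun L => c :: L

theorem mem_blockings {w c : List α} {L : List (List α)} :
    L ∈ blockings w c ↔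
      ∃ d L', L = (c ++ d) :: L' ∧ d ++ L'.flatten = w ∧ ∀ l ∈ L', l ≠ [] := by
  induction w generalizing c L with
  | nil =>
    simp only [blockings, List.mem_singleton]
    constructor
    · rintro rfl
      exact ⟨[], [], by simp⟩
    · rintro ⟨d, L', rfl, h, hL⟩
      obtain ⟨rfl, h⟩ := List.append_eq_nil_iff.1 h
      cases L' with
      | nil => simp
      | cons l L' => simp at h hL; exact absurd h.1 hL.1
  | cons y w ih =>
    simp only [blockings, List.mem_append, List.mem_map, ih]
    constructor
    · rintro (⟨d, L', rfl, h, hL⟩ | ⟨_, ⟨d, L', rfl, h, hL⟩, rfl⟩)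
      · exact ⟨y :: d, L', by simp, by simp [h], hL⟩
      · refine ⟨[], ([y] ++ d) :: L', by simp, by simp [h], ?_⟩
        simpa using hL
    · rintro ⟨d, L', rfl, h, hL⟩
      cases d with
      | cons z d =>
        simp only [List.cons_append, List.cons.injEq] at h
        obtain ⟨rfl, h⟩ := h
        exact Or.inl ⟨d, L', by simp, h, hL⟩
      | nil =>
        cases L' with
        | nil => simp at h
        | cons l L' =>
          cases l with
          | nil => simp at hL
          | cons z l =>
            simp only [List.nil_append, List.flatten_cons, List.cons_append,
              List.cons.injEq] at h
            obtain ⟨rfl, h⟩ := h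
            exact Or.inr ⟨_, ⟨l, L', rfl, h, fun l' hl' => hL l' (List.mem_cons_of_mem _ hl')⟩,
              by simp⟩

theorem nodup_blockings (w c : List α) : (blockings w c).Nodup := by
  induction w generalizing c with
  | nil => simp [blockings]
  | cons y w ih =>
    rw [blockings, List.nodup_append]
    refine ⟨ih _, (ih _).map fun _ _ h => by simpa using h, ?_⟩
    rintro L hL _ hM rfl
    obtain ⟨d, L', rfl, -, -⟩ := mem_blockings.1 hL
    obtain ⟨M, -, h⟩ := List.mem_map.1 hM
    simp at h

theorem sum_splitWrtComposition {M : Type*} [AddCommMonoid M] (x : α) (w : List α)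
    (f : List (List α) → M) :
    ∑ κ : Composition (x :: w).length, f ((x :: w).splitWrtComposition κ) =
      ((blockings w [x]).map f).sum := by
  classical
  rw [← List.sum_toFinset f (nodup_blockings w [x])]
  refine Finset.sum_bij (fun κ _ => (x :: w).splitWrtComposition κ) ?_ ?_ ?_ fun _ _ => rfl
  · intro κ _
    rw [List.mem_toFinset, mem_blockings]
    have h1 := List.flatten_splitWrtComposition (x :: w) κ
    have h2 : ∀ l ∈ (x :: w).splitWrtComposition κ, l ≠ [] := fun l hl =>
      List.length_pos_iff.1 (List.length_pos_of_mem_splitWrtComposition hl)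
    generalize (x :: w).splitWrtComposition κ = L at h1 h2
    match L, h1, h2 with
    | [], h1, _ => simp at h1
    | [] :: _, _, h2 => simp at h2
    | (y :: d) :: L', h1, h2 =>
      simp only [List.flatten_cons, List.cons_append, List.cons.injEq] at h1
      obtain ⟨rfl, h3⟩ := h1
      exact ⟨d, L', rfl, h3, fun l hl => h2 l (List.mem_cons_of_mem _ hl)⟩
  · intro κ _ κ' _ h
    have h1 := congrArg (List.map List.length) h
    simp only [List.map_length_splitWrtComposition] at h1
    exact Composition.ext h1
  · intro L hL
    rw [List.mem_toFinset, mem_blockings] at hL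
    obtain ⟨d, L', rfl, h, hL'⟩ := hL
    have hfl : ((([x] ++ d) :: L').flatten) = x :: w := by simp [h]
    refine ⟨⟨(([x] ++ d) :: L').map List.length, ?_, ?_⟩, Finset.mem_univ _, ?_⟩
    · intro i hi
      obtain ⟨l, hl, rfl⟩ := List.mem_map.1 hi
      rw [List.length_pos_iff]
      rcases List.mem_cons.1 hl with rfl | hl
      · simp
      · exact hL' l hl
    · rw [← hfl, List.length_flatten]
    · rw [List.eq_iff_flatten_eq]
      exact ⟨by rw [List.flatten_splitWrtComposition, hfl],
        List.map_length_splitWrtComposition _ _⟩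

end Blockings

/-! ### A recursive form of `ganit` -/

section Gan

variable {X R : Type*} [AddCommGroup X] [CommRing R] {O : X → X → R}

/-- The part of `ganit (oz O) A (x :: w)` in which the letter `x` has already absorbed a block:
the letters of `w` are read one after the other, and each of them either joins the current block,
of first letter `x`, or opens the next one. -/
def ganAux (O : X → X → R) : List (Letter X) → Letter X → (List (Letter X) → R) → R
  | [], x, A => A [x]
  | y :: w, x, A => O y.1 (y.2 - x.2) * ganAux O w (x.1 + y.1, x.2) A +
      ganAux O w y fun v => A (x :: v)

/-- The operator `ganit (oz O)`, in a form which is recursive in the word. -/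
def gan (O : X → X → R) (A : List (Letter X) → R) : List (Letter X) → R
  | [] => A []
  | x :: w => ganAux O w x A

/-- The sum that defines `ganit`, restricted to the blockings whose first block begins with `x c`. -/
theorem sum_map_blockings (A : Bimould X R) (w c : List (Letter X)) (x : Letter X) :
    ((blockings w (x :: c)).map fun L =>
      A (L.flatMap fun bc => upRight (bc.take 1) (bc.drop 1)) *
        (L.map fun bc => oz O (lowLeft (bc.take 1) (bc.drop 1))).prod).sum =
      ozAt O x.2 c * ganAux O w (x.1 + uSum c, x.2) A := by
  have hblock : ∀ (x : Letter X) (c : List (Letter X)),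
      oz O (lowLeft [x] c) = ozAt O x.2 c := fun x c => by
    simp [oz, lowLeft, ozAt, Function.comp_def]
  induction w generalizing A c x with
  | nil => simp [blockings, ganAux, hblock, upRight, mul_comm]
  | cons y w ih =>
    rw [blockings, List.map_append, List.sum_append, List.cons_append, ih, List.map_map]
    have h := ih (fun v => A ((x.1 + uSum c, x.2) :: v)) [] y
    simp only [ozAt_nil, one_mul, uSum_nil, add_zero] at h
    rw [ganAux, ← h, mul_add, ← List.sum_map_mul_left]
    congr 1
    · simp [add_assoc, mul_assoc]
    · congr 1
      refine List.map_congr_left fun L _ => ?_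
      simp [hblock, upRight]
      ring

theorem ganit_oz_eq_gan (A : Bimould X R) : ganit (oz O) A = gan O A := by
  funext w
  cases w with
  | nil =>
    have h : ∀ κ : Composition ([] : List (Letter X)).length,
        ([] : List (Letter X)).splitWrtComposition κ = [] := fun κ => by
      have h1 := List.length_splitWrtComposition ([] : List (Letter X)) κ
      have h2 : κ.length ≤ 0 := κ.length_le
      exact List.length_eq_zero_iff.1 (by omega)
    have h2 : Fintype.card (Composition 0) = 1 := by rw [composition_card]; rfl
    simp [ganit, h, gan, h2]
  | cons x w =>
    have h := sum_map_blockings (O := O) A w [] x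
    simp only [ozAt_nil, one_mul, uSum_nil, add_zero] at h
    rw [gan, ← h]
    exact sum_splitWrtComposition x w fun L =>
      A (L.flatMap fun bc => upRight (bc.take 1) (bc.drop 1)) *
        (L.map fun bc => oz O (lowLeft (bc.take 1) (bc.drop 1))).prod

theorem ganAux_congr {A B : List (Letter X) → R} {w : List (Letter X)} {x : Letter X}
    (h : ∀ v, uSum v = uSum (x :: w) → A v = B v) : ganAux O w x A = ganAux O w x B := by
  induction w generalizing A B x with
  | nil => exact h _ rfl
  | cons y w ih =>
    rw [ganAux, ganAux, ih fun v hv => h v (by simpa [add_assoc] using hv),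
      ih (x := y) fun v hv => h (x :: v) (by simpa using hv)]

/-- The sum of the upper entries is invariant under the contractions that occur in `gan`. -/
theorem gan_congr {A B : List (Letter X) → R} {w : List (Letter X)}
    (h : ∀ v, uSum v = uSum w → A v = B v) : gan O A w = gan O B w := by
  cases w with
  | nil => exact h [] rfl
  | cons x w => exact ganAux_congr h

theorem ganAux_add (A B : List (Letter X) → R) (w : List (Letter X)) (x : Letter X) :
    ganAux O w x (fun v => A v + B v) = ganAux O w x A + ganAux O w x B := by
  induction w generalizing A B x with
  | nil => rfl
  | cons y w ih => simp only [ganAux, ih]; ring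

theorem ganAux_mul_left (c : R) (A : List (Letter X) → R) (w : List (Letter X)) (x : Letter X) :
    ganAux O w x (fun v => c * A v) = c * ganAux O w x A := by
  induction w generalizing A x with
  | nil => rfl
  | cons y w ih => simp only [ganAux, ih]; ring

theorem gan_add (A B : List (Letter X) → R) (w : List (Letter X)) :
    gan O (fun v => A v + B v) w = gan O A w + gan O B w := by
  cases w with
  | nil => rfl
  | cons x w => exact ganAux_add A B w x

theorem gan_mul_left (c : R) (A : List (Letter X) → R) (w : List (Letter X)) :
    gan O (fun v => c * A v) w = c * gan O A w := by
  cases w with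
  | nil => rfl
  | cons x w => exact ganAux_mul_left c A w x

theorem gan_zero (w : List (Letter X)) : gan O (fun _ => 0) w = 0 := by
  simpa using gan_mul_left (O := O) 0 (fun _ => 0) w

theorem gan_finset_sum {ι : Type*} (s : Finset ι) (A : ι → List (Letter X) → R)
    (w : List (Letter X)) : gan O (fun v => ∑ i ∈ s, A i v) w = ∑ i ∈ s, gan O (A i) w := by
  classical
  induction s using Finset.induction_on with
  | empty => simp [gan_zero]
  | insert i s hi ih => simp only [Finset.sum_insert hi, gan_add, ih]

/-- The expansion of `ganAux` with respect to the first block. -/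
theorem ganAux_eq_splitSum (A : List (Letter X) → R) (w : List (Letter X)) (x : Letter X) :
    ganAux O w x A = splitSum w fun p q =>
      ozAt O x.2 p * gan O (fun v => A ((x.1 + uSum p, x.2) :: v)) q := by
  induction w generalizing A x with
  | nil => simp [ganAux, splitSum, gan]
  | cons y w ih =>
    rw [ganAux, ih, splitSum, add_comm, ← splitSum_mul_left]
    congr 1
    · simp [gan]
    · refine splitSum_congr fun p q _ => ?_
      simp [add_assoc, mul_assoc]

/-- The second summand collects the terms in which the left factor is empty. -/
theorem ganAux_conv (A B : List (Letter X) → R) (w : List (Letter X)) (x : Letter X) :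
    ganAux O w x (conv A B) =
      conv (fun p => ganAux O p x A) (gan O B) w + A [] * ganAux O w x B := by
  induction w generalizing A x with
  | nil => simp [ganAux, conv, splitSum, gan]; ring
  | cons y w ih =>
    have h : conv (fun p => ganAux O (y :: p) x A) (gan O B) w =
        O y.1 (y.2 - x.2) * conv (fun p => ganAux O p (x.1 + y.1, x.2) A) (gan O B) w +
          conv (fun p => ganAux O p y fun v => A (x :: v)) (gan O B) w := by
      simp only [conv, ganAux, ← splitSum_mul_left, ← splitSum_add]
      exact splitSum_congr fun p q _ => by ring
    rw [conv_cons, h]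
    simp only [conv_cons, ganAux_add, ganAux_mul_left, ih, ganAux, gan]
    ring

/-- The operator `ganit (oz O)` respects the concatenation product. -/
theorem gan_conv (A B : List (Letter X) → R) (w : List (Letter X)) :
    gan O (conv A B) w = conv (gan O A) (gan O B) w := by
  cases w with
  | nil => rfl
  | cons x w =>
    rw [gan, ganAux_conv, conv_cons, add_comm]
    rfl

/-- The first summand collects the terms in which the root is the current letter `x`. -/
theorem ganAux_rootSum (A B : X → List (Letter X) → R) (w : List (Letter X)) (x : Letter X) :
    ganAux O w x (fun v => rootSum v fun p y q => A y.2 p * B y.2 q) =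
      A x.2 [] * conv (ozAt O x.2) (gan O (B x.2)) w +
        rootSum w fun p y q =>
          ganAux O p x (A y.2) * conv (ozAt O y.2) (gan O (B y.2)) q := by
  induction w generalizing A x with
  | nil => simp [ganAux, rootSum, conv, splitSum, gan]
  | cons y w ih =>
    have h1 : conv (fun p => ozAt O x.2 (y :: p)) (gan O (B x.2)) w =
        O y.1 (y.2 - x.2) * conv (ozAt O x.2) (gan O (B x.2)) w := by
      simp only [conv, ← splitSum_mul_left]
      exact splitSum_congr fun p q _ => by rw [ozAt_cons]; ring
    have h2 : (rootSum w fun p z q =>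
        ganAux O (y :: p) x (A z.2) * conv (ozAt O z.2) (gan O (B z.2)) q) =
        O y.1 (y.2 - x.2) * (rootSum w fun p z q =>
          ganAux O p (x.1 + y.1, x.2) (A z.2) * conv (ozAt O z.2) (gan O (B z.2)) q) +
        rootSum w fun p z q => ganAux O p y (fun v => A z.2 (x :: v)) *
          conv (ozAt O z.2) (gan O (B z.2)) q := by
      rw [← rootSum_mul_left, ← rootSum_add]
      exact rootSum_congr fun p z q _ => by rw [ganAux]; ring
    have h3 := ih (fun s p => A s (x :: p)) y
    rw [rootSum, conv_cons, h1, h2]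
    simp only [rootSum, ganAux_add, ganAux_mul_left, h3, ih, ganAux, gan, ozAt_nil]
    ring

/-- The effect of `ganit (oz O)` on a bimould that is obtained by inserting a root between two
factors: the letters of the block of the root are absorbed by the right factor. -/
theorem gan_rootSum (A B : X → List (Letter X) → R) (w : List (Letter X)) :
    gan O (fun v => rootSum v fun p y q => A y.2 p * B y.2 q) w =
      rootSum w fun p y q => gan O (A y.2) p * conv (ozAt O y.2) (gan O (B y.2)) q := by
  cases w with
  | nil => rfl
  | cons x w => exact ganAux_rootSum A B w x

end Gan

/-! ### The group-like bimould that `ganit (oz O)` sends to `1 - O` -/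

section Combs

variable {X R : Type*} [AddCommGroup X] [CommRing R] {D : Deck X} {O : X → X → R}

/-- The words which become admissible when their lower entries are taken relative to `s`. -/
def Deck.relWords (D : Deck X) (s : X) : Set (List (Letter X)) :=
  {w | w.map (lowerShift s) ∈ D.words}

theorem Deck.sublistClosed_relWords (D : Deck X) (s : X) : SublistClosed (D.relWords s) :=
  fun _ _ h hs => Deck.map_shift_mem_of_sublist h hs

/-- The bimould `(-1)^r O(u_1 + ⋯ + u_r, v_1 - s) O(u_2 + ⋯ + u_r, v_2 - v_1) ⋯ O(u_r, v_r - v_{r-1})`,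
relative to the base point `s`. -/
def combAt (O : X → X → R) : X → List (Letter X) → R
  | _, [] => 1
  | s, x :: w => -(O (x.1 + uSum w) (x.2 - s) * combAt O x.2 w)

/-- The powers of `combAt O s` with respect to the concatenation product. -/
def combPow (O : X → X → R) (s : X) : ℕ → List (Letter X) → R
  | 0 => convOne
  | N + 1 => conv (combAt O s) (combPow O s N)

theorem combPow_nil (s : X) (N : ℕ) : combPow O s N [] = 1 := by
  induction N with
  | zero => rfl
  | succ N ih => rw [combPow, conv_nil, ih, combAt, mul_one]

theorem isSymmetralOn_combAt (hO : D.IsFlexionUnit O) (s : X) :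
    IsSymmetralOn (D.relWords s) (combAt O s) := by
  intro a b h
  induction a, b using shuffles.induct generalizing s with
  | case1 b => simp [shuffleSum_nil_left, combAt]
  | case2 a _ => simp [shuffleSum_nil_right, combAt]
  | case3 x a y b ih1 ih2 =>
    have hx : a ++ y :: b ∈ D.relWords x.2 := Deck.rebase_mem h
    have hy : x :: a ++ b ∈ D.relWords y.2 :=
      Deck.rebase_mem (Deck.map_shift_mem_of_perm h (List.perm_middle (l₁ := x :: a)))
    have e1 : shuffleSum (fun w => combAt O s (x :: w)) a (y :: b) =
        -O (uSum (x :: a ++ y :: b)) (x.2 - s) * shuffleSum (combAt O x.2) a (y :: b) := by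
      rw [← shuffleSum_mul_left]
      refine shuffleSum_congr fun w hw => ?_
      rw [combAt, uSum_perm hw, List.cons_append, uSum_cons, neg_mul]
    have e2 : shuffleSum (fun w => combAt O s (y :: w)) (x :: a) b =
        -O (uSum (x :: a ++ y :: b)) (y.2 - s) * shuffleSum (combAt O y.2) (x :: a) b := by
      rw [← shuffleSum_mul_left]
      refine shuffleSum_congr fun w hw => ?_
      rw [combAt, uSum_perm hw, uSum_perm (List.perm_middle (l₁ := x :: a)), uSum_cons, neg_mul]
    have ht := hO.tripartite _ _ _ _ (Deck.merge_pair_mem h)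
    rw [sub_sub_sub_cancel_right, sub_sub_sub_cancel_right] at ht
    have hu : uSum (x :: a ++ y :: b) = x.1 + uSum a + (y.1 + uSum b) := by
      simp [add_assoc]
    rw [shuffleSum_cons_cons, e1, e2, ih1 x.2 hx, ih2 y.2 hy, hu]
    simp only [combAt]
    linear_combination -(combAt O x.2 a * combAt O y.2 b) * ht

theorem isSymmetralOn_combPow (hO : D.IsFlexionUnit O) (s : X) (N : ℕ) :
    IsSymmetralOn (D.relWords s) (combPow O s N) := by
  induction N with
  | zero => exact isSymmetralOn_convOne _
  | succ N ih => exact isSymmetralOn_conv (D.sublistClosed_relWords s) (isSymmetralOn_combAt hO s) ih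

/-! ### Power series in the unit -/

/-- The value of the power series `c` at the bimould `O`, relative to the base point `s`, the
product being the concatenation product. -/
noncomputable def seriesAt (O : X → X → R) (c : PowerSeries R) (s : X) (w : List (Letter X)) : R :=
  PowerSeries.coeff w.length c * ozAt O s w

theorem conv_seriesAt (c d : PowerSeries R) (s : X) :
    conv (seriesAt O c s) (seriesAt O d s) = seriesAt O (c * d) s := by
  funext w
  rw [seriesAt, PowerSeries.coeff_mul,
    ← splitSum_length w fun i j => PowerSeries.coeff i c * PowerSeries.coeff j d, mul_comm,
    ← splitSum_mul_left]
  refine splitSum_congr fun p q h => ?_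
  rw [← h, ozAt_append, seriesAt, seriesAt]
  ring

theorem seriesAt_one (s : X) : seriesAt O 1 s = convOne := by
  funext w
  cases w <;> simp [seriesAt, convOne, PowerSeries.coeff_one]

theorem seriesAt_mk_one (s : X) : seriesAt O (PowerSeries.mk 1) s = ozAt O s := by
  funext w
  simp [seriesAt]

theorem gan_convOne : gan O (convOne : List (Letter X) → R) = convOne := by
  funext w
  cases w with
  | nil => rfl
  | cons x w =>
    rw [gan, ganAux_eq_splitSum]
    simp only [convOne, gan_zero, mul_zero, splitSum_zero]

/-- The geometric series `oz` that is created by the block of the first letter cancels against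
the value `1 - O` on the remaining letters. -/
theorem gan_combAt (s : X) : gan O (combAt O s) = seriesAt O (1 - PowerSeries.X) s := by
  funext w
  induction hn : w.length using Nat.strong_induction_on generalizing w s with
  | _ n ih =>
    cases w with
    | nil => simp [gan, combAt, seriesAt]
    | cons x w =>
      have h : ganAux O w x (combAt O s) = -O (x.1 + uSum w) (x.2 - s) *
          conv (seriesAt O (PowerSeries.mk 1) x.2) (seriesAt O (1 - PowerSeries.X) x.2) w := by
        rw [ganAux_eq_splitSum, conv, ← splitSum_mul_left]
        refine splitSum_congr fun p q hpq => ?_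
        rw [gan_congr (B := fun v => -O (x.1 + uSum w) (x.2 - s) * combAt O x.2 v),
          gan_mul_left, ih q.length _ x.2 q rfl, seriesAt_mk_one]
        · ring
        · rw [← hn, ← hpq]; simp
        · intro v hv
          rw [combAt, hv, ← hpq, uSum_append, add_assoc, neg_mul]
      rw [gan, h, conv_seriesAt, PowerSeries.mk_one_mul_one_sub_eq_one, seriesAt_one]
      cases w with
      | nil => simp [seriesAt, convOne, PowerSeries.coeff_one]
      | cons y w => simp [seriesAt, convOne, PowerSeries.coeff_one, PowerSeries.coeff_X]

theorem gan_combPow (s : X) (N : ℕ) :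
    gan O (combPow O s N) = seriesAt O ((1 - PowerSeries.X) ^ N) s := by
  induction N with
  | zero => rw [combPow, gan_convOne, pow_zero, seriesAt_one]
  | succ N ih =>
    funext w
    rw [combPow, gan_conv, gan_combAt, ih, conv_seriesAt, pow_succ']

theorem gan_convInv_combPow (s : X) (N : ℕ) :
    gan O (convInv (combPow O s N)) = seriesAt O (PowerSeries.mk 1 ^ N) s := by
  refine conv_left_cancel (A := seriesAt O ((1 - PowerSeries.X) ^ N) s) ?_ ?_
  · simp [seriesAt]
  -- Both sides are inverse to the image of `combPow O s N`.
  · rw [conv_seriesAt, ← mul_pow, mul_comm, PowerSeries.mk_one_mul_one_sub_eq_one, one_pow,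
      seriesAt_one, ← gan_combPow]
    funext w
    rw [← gan_conv, conv_convInv (combPow_nil s N), gan_convOne]

/-! ### Alternal bimoulds obtained by conjugation -/

/-- The unit `O`, as a root, between the `N`-th power of `combAt` and its inverse. -/
def conjRoot (O : X → X → R) (N : ℕ) (w : List (Letter X)) : R :=
  rootSum w fun p x q =>
    O (uSum w) x.2 * (combPow O x.2 N p * convInv (combPow O x.2 N) q)

/-- If the root belongs to `a`, the letters of `b` are distributed over the two factors, and the
sum over all possibilities is a value of the product of a power of `combAt` and its inverse. -/
theorem isAlternal_conjRoot (hO : D.IsFlexionUnit O) (N : ℕ) : D.IsAlternal (conjRoot O N) := by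
  refine ⟨rfl, fun a b ha hb h => ?_⟩
  have hzero : ∀ (s : X) {c : List (Letter X)}, c ≠ [] →
      conv (combPow O s N) (convInv (combPow O s N)) c = 0 := by
    intro s c hc
    rw [conv_convInv (combPow_nil s N)]
    cases c with
    | nil => exact absurd rfl hc
    | cons => rfl
  have hsym := fun s => isSymmetralOn_combPow hO s N
  have hsym' := fun s => isSymmetralOn_convInv (D.sublistClosed_relWords s) (hsym s)
    (combPow_nil s N)
  have hinner : ∀ (x : Letter X) (a₁ a₂ b₁ b₂ : List (Letter X)),
      (a₁ ++ a₂) ++ (b₁ ++ b₂) ∈ D.relWords x.2 →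
      shuffleSum (fun p => shuffleSum (fun q => O (uSum (a ++ b)) x.2 *
        (combPow O x.2 N p * convInv (combPow O x.2 N) q)) a₂ b₂) a₁ b₁ =
        O (uSum (a ++ b)) x.2 * ((combPow O x.2 N a₁ * convInv (combPow O x.2 N) a₂) *
          (combPow O x.2 N b₁ * convInv (combPow O x.2 N) b₂)) := by
    intro x a₁ a₂ b₁ b₂ hmem
    obtain ⟨h1, h2⟩ := sublist_append_split (rfl : a₁ ++ a₂ = _) (rfl : b₁ ++ b₂ = _)
    have hC := D.sublistClosed_relWords x.2
    have e : ∀ p, shuffleSum (fun q => O (uSum (a ++ b)) x.2 *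
        (combPow O x.2 N p * convInv (combPow O x.2 N) q)) a₂ b₂ =
        (O (uSum (a ++ b)) x.2 *
          (convInv (combPow O x.2 N) a₂ * convInv (combPow O x.2 N) b₂)) * combPow O x.2 N p := by
      intro p
      rw [← hsym' x.2 _ _ (hC _ _ hmem h2), shuffleSum_mul_left, shuffleSum_mul_left]
      ring
    simp only [e]
    rw [shuffleSum_mul_left, hsym x.2 _ _ (hC _ _ hmem h1)]
    ring
  change shuffleSum (conjRoot O N) a b = 0
  rw [shuffleSum_congr (B := fun w => rootSum w fun p x q => O (uSum (a ++ b)) x.2 *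
    (combPow O x.2 N p * convInv (combPow O x.2 N) q)) fun w hw => by
      rw [conjRoot, uSum_perm hw], shuffleSum_rootSum,
    rootSum_congr (w := a) (G := fun _ _ _ => 0), rootSum_zero,
    rootSum_congr (w := b) (G := fun _ _ _ => 0), rootSum_zero, add_zero]
  · intro b₁ y b₂ hb'
    rw [splitSum_congr (G := fun a₁ a₂ => O (uSum (a ++ b)) y.2 *
      (combPow O y.2 N b₁ * convInv (combPow O y.2 N) b₂) *
        (combPow O y.2 N a₁ * convInv (combPow O y.2 N) a₂)), splitSum_mul_left]
    · change _ * conv _ _ a = 0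
      rw [hzero _ ha, mul_zero]
    · intro a₁ a₂ ha'
      rw [hinner]
      · ring
      · rw [ha']
        refine Deck.shift_mem (Deck.mem_of_perm h ?_)
        rw [← hb', ← List.append_assoc, ← List.append_assoc]
        exact List.perm_middle
  · intro a₁ x a₂ ha'
    rw [splitSum_congr (G := fun b₁ b₂ => O (uSum (a ++ b)) x.2 *
      (combPow O x.2 N a₁ * convInv (combPow O x.2 N) a₂) *
        (combPow O x.2 N b₁ * convInv (combPow O x.2 N) b₂)), splitSum_mul_left]
    · change _ * conv _ _ b = 0
      rw [hzero _ hb, mul_zero]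
    · intro b₁ b₂ hb'
      rw [hinner]
      · ring
      · rw [hb']
        refine Deck.shift_mem (Deck.mem_of_perm h ?_)
        rw [← ha', List.append_assoc, List.append_assoc]
        exact List.perm_middle

theorem gan_conjRoot (N : ℕ) (w : List (Letter X)) :
    gan O (conjRoot O N) w = corollaSum O (fun i j =>
      PowerSeries.coeff i ((1 - PowerSeries.X) ^ N : PowerSeries R) *
        PowerSeries.coeff j (PowerSeries.mk 1 ^ (N + 1) : PowerSeries R)) 0 w := by
  rw [gan_congr (B := fun v => rootSum v fun p x q => O (uSum w) x.2 * combPow O x.2 N p *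
    convInv (combPow O x.2 N) q), gan_rootSum (fun s p => O (uSum w) s * combPow O s N p) fun s => convInv (combPow O s N)]
  · refine rootSum_congr fun p x q _ => ?_
    have hq : conv (ozAt O x.2) (seriesAt O (PowerSeries.mk 1 ^ N) x.2) =
        seriesAt O (PowerSeries.mk 1 ^ (N + 1)) x.2 := by
      rw [← seriesAt_mk_one, conv_seriesAt, ← pow_succ']
    rw [gan_mul_left, gan_combPow, gan_convInv_combPow, hq, seriesAt, seriesAt, sub_zero]
    ring
  · intro v hv
    rw [conjRoot, hv]
    exact rootSum_congr fun p x q _ => by ring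

end Combs

/-! ### The rational coefficients -/

section Coefficients

theorem coeff_one_sub_X_pow {R : Type*} [CommRing R] (N i : ℕ) :
    PowerSeries.coeff i ((1 - PowerSeries.X) ^ N : PowerSeries R) =
      (-1) ^ i * (N.choose i : R) := by
  induction N generalizing i with
  | zero => cases i <;> simp [PowerSeries.coeff_one]
  | succ N ih =>
    rw [pow_succ, mul_sub, mul_one, map_sub, ih]
    cases i with
    | zero => simp
    | succ i =>
      rw [PowerSeries.coeff_succ_mul_X, ih, Nat.choose_succ_succ, pow_succ]
      push_cast
      ring

theorem coeff_mk_one_pow_succ {R : Type*} [CommRing R] (N j : ℕ) :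
    PowerSeries.coeff j (PowerSeries.mk 1 ^ (N + 1) : PowerSeries R) =
      ((N + j).choose N : R) := by
  rw [PowerSeries.mk_one_pow_eq_mk_choose_add, PowerSeries.coeff_mk]

/-- The coefficients of the linear form `q ↦ ∑_{M < n} (δ^M q)(0) / ((M + 1) (M + 2))` with respect
to the values `q 0, …, q (n - 1)`, where `(δ q) N = q N - q (N + 1)`. -/
def weight (n N : ℕ) : ℚ :=
  ∑ M ∈ Finset.range n, (-1) ^ N * (M.choose N : ℚ) / (((M : ℚ) + 1) * ((M : ℚ) + 2))

/-- The coefficient of `X ^ i` in `X ^ M = (1 - (1 - X)) ^ M`. -/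
theorem sum_neg_one_pow_choose_mul_choose {n M : ℕ} (hM : M < n) (i : ℕ) :
    ∑ N ∈ Finset.range n, (-1) ^ N * (M.choose N : ℚ) * ((-1) ^ i * (N.choose i : ℚ)) =
      if i = M then 1 else 0 := by
  have h := add_pow (-(1 - PowerSeries.X) : PowerSeries ℚ) 1 M
  rw [neg_sub, sub_add_cancel] at h
  have h1 := congrArg (PowerSeries.coeff i) h
  rw [PowerSeries.coeff_X_pow, map_sum] at h1
  rw [h1]
  symm
  rw [Finset.sum_subset (Finset.range_mono (Nat.succ_le_of_lt hM))]
  · refine Finset.sum_congr rfl fun N _ => ?_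
    rw [one_pow, mul_one, ← neg_sub, neg_pow,
      ← coeff_one_sub_X_pow (R := ℚ) N i,
      show ((-1 : PowerSeries ℚ) ^ N * (1 - PowerSeries.X) ^ N) * (M.choose N : PowerSeries ℚ) =
        PowerSeries.C ((-1) ^ N * (M.choose N : ℚ)) * (1 - PowerSeries.X) ^ N by
          simp; ring, PowerSeries.coeff_C_mul]
  · intro N _ hN
    rw [Nat.choose_eq_zero_of_lt (by simpa using hN)]
    simp

/-- Both sides satisfy the recursion
`(j + 1) q i (j + 1) = -(i + 1) q (i + 1) j + (i + j + 1) q i j`, which reduces the claim to `j = 0`,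
where the linear form given by `weight` picks out the term `M = i`. -/
theorem sum_weight_mul {n i j : ℕ} (h : i + j < n) :
    ∑ N ∈ Finset.range n, weight n N * ((-1) ^ i * (N.choose i : ℚ) * ((N + j).choose N : ℚ)) =
      ((j : ℚ) + 1) / (((i : ℚ) + j + 1) * ((i : ℚ) + j + 2)) := by
  induction j generalizing i with
  | zero =>
    simp only [weight, Finset.sum_mul]
    rw [Finset.sum_comm, Finset.sum_eq_single i]
    · have := sum_neg_one_pow_choose_mul_choose h i
      rw [if_pos (by simp)] at this
      calc _ = ∑ N ∈ Finset.range n, (1 / (((i : ℚ) + 1) * ((i : ℚ) + 2))) *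
            ((-1) ^ N * ((i + 0).choose N : ℚ) * ((-1) ^ i * (N.choose i : ℚ))) := by
            refine Finset.sum_congr rfl fun N _ => ?_
            simp only [Nat.add_zero, Nat.choose_self, Nat.cast_one, mul_one]
            ring
        _ = _ := by
            rw [← Finset.mul_sum, this]
            simp
    · intro M hM hne
      have := sum_neg_one_pow_choose_mul_choose (Finset.mem_range.1 hM) i
      rw [if_neg (fun e => hne e.symm)] at this
      calc _ = ∑ N ∈ Finset.range n, (1 / (((M : ℚ) + 1) * ((M : ℚ) + 2))) *
            ((-1) ^ N * (M.choose N : ℚ) * ((-1) ^ i * (N.choose i : ℚ))) := by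
            refine Finset.sum_congr rfl fun N _ => ?_
            simp only [Nat.add_zero, Nat.choose_self, Nat.cast_one, mul_one]
            ring
        _ = _ := by rw [← Finset.mul_sum, this, mul_zero]
    · intro hi
      exact absurd (Finset.mem_range.2 (by omega)) hi
  | succ j ih =>
    have h1 := ih (i := i) (by omega)
    have h2 := ih (i := i + 1) (by omega)
    have hrec : ∀ N : ℕ, ((j : ℚ) + 1) *
        ((-1) ^ i * (N.choose i : ℚ) * ((N + (j + 1)).choose N : ℚ)) =
        -((i : ℚ) + 1) * ((-1) ^ (i + 1) * (N.choose (i + 1) : ℚ) * ((N + j).choose N : ℚ)) +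
          ((i : ℚ) + j + 1) * ((-1) ^ i * (N.choose i : ℚ) * ((N + j).choose N : ℚ)) := by
      intro N
      have e1 : ((N + (j + 1)).choose N : ℚ) * (j + 1) = (N + j + 1) * ((N + j).choose N : ℚ) := by
        rw [Nat.choose_symm_add, Nat.choose_symm_add]
        exact_mod_cast (Nat.add_one_mul_choose_eq (N + j) j).symm
      have e2 : (N.choose (i + 1) : ℚ) * (i + 1) = (N.choose i : ℚ) * ((N : ℚ) - i) := by
        rcases le_or_gt i N with hi | hi
        · have := Nat.choose_succ_right_eq N i
          rw [← Nat.cast_sub hi]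
          exact_mod_cast this
        · rw [Nat.choose_eq_zero_of_lt hi, Nat.choose_eq_zero_of_lt (by omega)]
          simp
      rw [pow_succ]
      linear_combination (-1) ^ i * (N.choose i : ℚ) * e1 -
        (-1) ^ i * ((N + j).choose N : ℚ) * e2
    have hsum : ((j : ℚ) + 1) * ∑ N ∈ Finset.range n, weight n N *
        ((-1) ^ i * (N.choose i : ℚ) * ((N + (j + 1)).choose N : ℚ)) =
        -((i : ℚ) + 1) * (∑ N ∈ Finset.range n, weight n N *
          ((-1) ^ (i + 1) * (N.choose (i + 1) : ℚ) * ((N + j).choose N : ℚ))) +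
        ((i : ℚ) + j + 1) * ∑ N ∈ Finset.range n, weight n N *
          ((-1) ^ i * (N.choose i : ℚ) * ((N + j).choose N : ℚ)) := by
      rw [Finset.mul_sum, Finset.mul_sum, Finset.mul_sum, ← Finset.sum_add_distrib]
      exact Finset.sum_congr rfl fun N _ => by linear_combination weight n N * hrec N
    rw [h1, h2] at hsum
    have hj : (j : ℚ) + 1 ≠ 0 := by positivity
    refine mul_left_cancel₀ hj (hsum.trans ?_)
    push_cast
    have p1 : (i : ℚ) + j + 1 ≠ 0 := by positivity
    have p2 : (i : ℚ) + j + 2 ≠ 0 := by positivity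
    have p3 : (i : ℚ) + j + 3 ≠ 0 := by positivity
    rw [show (i : ℚ) + 1 + j + 1 = i + j + 2 by ring, show (i : ℚ) + 1 + j + 2 = i + j + 3 by ring,
      show (i : ℚ) + (j + 1) + 1 = i + j + 2 by ring,
      show (i : ℚ) + (j + 1) + 2 = i + j + 3 by ring]
    field_simp
    ring

end Coefficients

/-! ### Alternality up to a given length -/

section Conclusion

variable {X R : Type*} [AddCommGroup X] [CommRing R] {D : Deck X} {O : X → X → R}

/-- The contractions in `ganAux` shorten the word, so only the uncontracted word contributes if `F`
vanishes on the shorter admissible words. -/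
theorem ganAux_eq_of_vanishing (F : List (Letter X) → R) (p : List (Letter X)) (x : Letter X)
    (w : List (Letter X)) (hmem : p ++ x :: w ∈ D.words)
    (h : ∀ v ∈ D.words, v.length < (p ++ x :: w).length → F v = 0) :
    ganAux O w x (fun v => F (p ++ v)) = F (p ++ x :: w) := by
  induction w generalizing p x with
  | nil => rfl
  | cons y w ih =>
    have hcontr : p ++ (x.1 + y.1, x.2) :: w ∈ D.words := by
      have h1 : x :: ([y] ++ (p ++ w)) ∈ D.words := by
        refine Deck.mem_of_perm hmem (List.perm_middle.trans (List.Perm.cons _ ?_))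
        exact List.perm_middle
      have h2 := Deck.merge_mem h1
      simp only [uSum_cons, uSum_nil, add_zero] at h2
      exact Deck.mem_of_perm h2 List.perm_middle.symm
    have h3 := ih p (x.1 + y.1, x.2) hcontr fun v hv hl => h v hv (by simp at hl ⊢; omega)
    rw [h _ hcontr (by simp)] at h3
    have h4 := ih (p ++ [x]) y (by simpa using hmem) fun v hv hl => h v hv (by simpa using hl)
    simp only [List.append_assoc, List.singleton_append] at h4
    rw [ganAux, h3, mul_zero, zero_add, h4]

/-- The operator `ganit (oz O)` is unitriangular with respect to the length, on admissible
words. -/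
theorem eq_of_gan_eq {A B : List (Letter X) → R} {n : ℕ}
    (h : ∀ w ∈ D.words, w.length ≤ n → gan O A w = gan O B w) {w : List (Letter X)}
    (hw : w ∈ D.words) (hn : w.length ≤ n) : A w = B w := by
  induction hl : w.length using Nat.strong_induction_on generalizing w with
  | _ l ih =>
    have h1 : gan O (fun v => A v + (-1) * B v) w = 0 := by
      rw [gan_add, gan_mul_left, h w hw hn]
      ring
    have h2 : gan O (fun v => A v + (-1) * B v) w = A w + (-1) * B w := by
      cases w with
      | nil => rfl
      | cons x w =>
        refine ganAux_eq_of_vanishing (fun v => A v + (-1) * B v) [] x w hw fun v hv hvl => ?_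
        simp only [List.nil_append, hl] at hvl
        rw [ih v.length hvl hv (by omega) rfl]
        ring
    rw [h2] at h1
    linear_combination h1

/-- The alternal bimould whose image under `ganit (oz O)` agrees with `To E` up to length `n`. -/
noncomputable def conjRootSum [Algebra ℚ R] (O : X → X → R) (n : ℕ) (w : List (Letter X)) : R :=
  ∑ N ∈ Finset.range n, algebraMap ℚ R (weight n N) * conjRoot O N w

theorem isAlternal_conjRootSum [Algebra ℚ R] (hO : D.IsFlexionUnit O) (n : ℕ) :
    D.IsAlternal (conjRootSum O n : Bimould X R) := by
  have h := isAlternal_conjRoot hO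
  refine ⟨?_, fun a b ha hb hab => ?_⟩
  · simp [conjRootSum, (h _).1]
  · change shuffleSum (conjRootSum O n) a b = 0
    have e : conjRootSum O n =
        fun w => ∑ N ∈ Finset.range n, algebraMap ℚ R (weight n N) * conjRoot O N w := rfl
    simp only [e, shuffleSum_finset_sum, shuffleSum_mul_left]
    refine Finset.sum_eq_zero fun N _ => ?_
    rw [show shuffleSum (conjRoot O N) a b = 0 from (h N).2 a b ha hb hab, mul_zero]

theorem gan_conjRootSum [Algebra ℚ R] {n : ℕ} {w : List (Letter X)} (hn : w.length ≤ n) :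
    gan O (conjRootSum O n) w = (1 / ((w.length : ℚ) * ((w.length : ℚ) + 1))) •
      corollaSum O (fun _ j => (j : R) + 1) 0 w := by
  have e : conjRootSum O n =
      fun w => ∑ N ∈ Finset.range n, algebraMap ℚ R (weight n N) * conjRoot O N w := rfl
  simp only [e, gan_finset_sum, gan_mul_left,
    gan_conjRoot, corollaSum, ← rootSum_mul_left, ← rootSum_finset_sum, Algebra.smul_def]
  refine rootSum_congr fun p x q hw => ?_
  have hl : p.length + 1 + q.length = w.length := by rw [← hw]; simp; omega
  have key := congrArg (algebraMap ℚ R)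
    (sum_weight_mul (n := n) (i := p.length) (j := q.length) (by omega))
  simp only [map_sum, map_mul, map_pow, map_neg, map_one, map_natCast] at key
  simp only [← mul_assoc, ← Finset.sum_mul, coeff_one_sub_X_pow, coeff_mk_one_pow_succ]
  congr 3
  simp only [← mul_assoc] at key
  rw [key, ← hl, ← map_natCast (algebraMap ℚ R), ← map_one (algebraMap ℚ R), ← map_add, ← map_mul]
  congr 1
  push_cast
  ring

end Conclusion

end Flexion

theorem mainTheorem10 {X R : Type*} [AddCommGroup X] [CommRing R] [Algebra ℚ R]
    (D : Flexion.Deck X) (E : X → X → R) (hE : D.IsFlexionUnit E) :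
    D.IsOAlternal (Flexion.conjUnit E) (Flexion.To E) := by
  let O := Flexion.conjUnit E
  let A := (Flexion.ganitEquiv (Flexion.oz O) (Flexion.oz_nil O)).symm (Flexion.To E)
  have hA : Flexion.gan O A = Flexion.To E := by
    rw [← Flexion.ganit_oz_eq_gan]
    exact (Flexion.ganitEquiv (Flexion.oz O) (Flexion.oz_nil O)).apply_symm_apply _
  refine ⟨?_, fun a b ha hb hab => ?_⟩
  · have h := congrFun hA []
    simpa [Flexion.To, Flexion.gan] using h
  · have heq : ∀ w ∈ D.words, w.length ≤ (a ++ b).length →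
        A w = Flexion.conjRootSum O (a ++ b).length w := by
      refine fun w hw hl => Flexion.eq_of_gan_eq (O := O) (fun v hv hvl => ?_) hw hl
      rw [hA, Flexion.gan_conjRootSum hvl]
      rcases eq_or_ne v [] with rfl | hne
      · simp [Flexion.To, Flexion.corollaSum_nil]
      · exact Flexion.To_eq_corollaSum hE hv hne
    have h := (Flexion.isAlternal_conjRootSum hE.conj (a ++ b).length).2 a b ha hb hab
    refine Eq.trans (Flexion.shuffleSum_congr fun w hw => ?_) h
    exact heq w (Flexion.Deck.mem_of_perm hab hw.symm) hw.length_eq.le
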